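/- **Setting.** Let $(\Omega,\mathcal F)$ be a measurable space and $\mathcal H$ a set of real random variables on it such that $I_A\in\mathcal H$ for all $A\in\mathcal F$, and $\varphi(Y_1,\dots,Y_n)\in\mathcal H$ whenever $Y_1,\dots,Y_n\in\mathcal H$ and $\varphi:\mathbb R^n\to\mathbb R$ satisfies $|\varphi(x)-\varphi(y)|\le C(1+|x|^m+|y|^m)|x-y|$ for some $C>0$, $m\in\mathbb N$. Let $\mathbb E:\mathcal H\to[-\infty,\infty]$ be a sublinear expectation: for $Y,Z\in\mathcal H$, $\mathbb E[Y]\le\mathbb E[Z]$ if $Y\le Z$; $\mathbb E[c]=c$ for $c\in\mathbb R$; $\mathbb E[\lambda Y]=\lambda\mathbb E[Y]$ for $\lambda\ge0$; and $\mathbb E[Y+Z]\le\mathbb E[Y]+\mathbb E[Z]$ unless the right side is of the form $\infty-\infty$ or $-\infty+\infty$. Assume that $\mathbb E$ is countably sub-additive: $\mathbb E[Y]\le\sum_{n\ge1}\mathbb E[Y_n]$ whenever $Y,Y_n\in\mathcal H$ are nonnegative and $Y\le\sum_{n\ge1}Y_n$. Put $V(A)=\inf\{\mathbb E[\xi]:\xi\in\mathcal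 H,\ I_A\le\xi\}$ and $$C_V(Y)=\int_0^\infty V(Y>x)\,dx+\int_{-\infty}^0\bigl(V(Y>x)-1\bigr)\,dx .$$ A random vector $\mathbf Y$ is independent of $\mathbf X$ if $\mathbb E[\psi(\mathbf X,\mathbf Y)]=\mathbb E\bigl[\mathbb E[\psi(x,\mathbf Y)]|_{x=\mathbf X}\bigr]$ for every Borel function $\psi$ with $\psi(\mathbf X,\mathbf Y)\in\mathcal H$ and $\psi(x,\mathbf Y)\in\mathcal H$ for all $x$, for which $\bar\psi(x):=\mathbb E|\psi(x,\mathbf Y)|<\infty$ for all $x$ and $\mathbb E[\bar\psi(\mathbf X)]<\infty$ (all functions to which $\mathbb E$ is applied being in $\mathcal H$). A sequence $X_1,X_2,\dots\in\mathcal H$ is independent if $X_{n+1}$ is independent of $(X_1,\dots,X_n)$ for each $n\ge1$. Two random variables $Y,Z\in\mathcal H$ are identically distributed if $\mathbb E[\psi(Y)]=\mathbb E[\psi(Z)]$ for every Borel function $\psi$ with $\psi(Y),\psi(Z)\in\mathcal H$ for which both expectations are finite. **Theorem 3.2.** Let $X_1,X_2,\dots\in\mathcal H$ be independent and each identically distributed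 as $X\in\mathcal H$. Let $r>1$, $p>\tfrac12$, $\beta+p>0$, and if $p\le1$ suppose that $\mathbb E[X]=-\mathbb E[-X]=0$. Let $(a_{ni})_{0\le i\le n-1,\,n\ge1}$ be a triangular array of real numbers with $a_{ni}\approx\left(\frac{n-i}{n}\right)^{\beta}\left(\frac1n\right)^{p}$, that is, there are constants $c,C>0$ such that, for all sufficiently large $n$ and all $0\le i\le n-1$, $$c\left(\tfrac{n-i}{n}\right)^{\beta}n^{-p}\le a_{ni}\le C\left(\tfrac{n-i}{n}\right)^{\beta}n^{-p}.$$ Then the following are equivalent: (i) $C_V\bigl(|X|^{(r-1)/(p+\beta)}\bigr)<\infty$ if $-p<\beta<-p/r$; $C_V\bigl(|X|^{r/p}\ln(1+|X|)\bigr)<\infty$ if $\beta=-p/r$; $C_V\bigl(|X|^{r/p}\bigr)<\infty$ if $\beta>-p/r$; (ii) for every $\varepsilon>0$, $$\sum_{n=1}^\infty n^{r-2}\,V\Bigl(\max_{0\le j\le n-1}\Bigl|\sum_{i=1}^{j}a_{ni}X_i\Bigr|>\varepsilon\Bigr)<\infty .$$ -/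

import Mathlib

open scoped ENNReal

noncomputable section

/-- `C_{l,Lip}(ℝⁿ)`: functions with `|φ x - φ y| ≤ C (1 + |x|^m + |y|^m) |x - y|` for some `C > 0`
and `m ∈ ℕ`. The class does not depend on the norm chosen on `ℝⁿ`. -/
def LocLipPoly {n : ℕ} (φ : (Fin n → ℝ) → ℝ) : Prop :=
  ∃ C : ℝ, 0 < C ∧ ∃ m : ℕ, ∀ x y : Fin n → ℝ,
    |φ x - φ y| ≤ C * (1 + ‖x‖ ^ m + ‖y‖ ^ m) * ‖x - y‖

/-- A sublinear expectation space `(Ω, H, E)` over the measurable space `Ω`. The functional `E` is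
only meaningful on `H`; its values at functions outside `H` are never used. -/
structure SublinearExpectation (Ω : Type*) [MeasurableSpace Ω] where
  /-- the set of admissible random variables -/
  H : Set (Ω → ℝ)
  /-- the sublinear expectation, with values in `[-∞, ∞]` -/
  E : (Ω → ℝ) → EReal
  measurable_of_mem : ∀ X ∈ H, Measurable X
  indicator_mem : ∀ A : Set Ω, MeasurableSet A → A.indicator (fun _ => (1 : ℝ)) ∈ H
  comp_mem : ∀ (n : ℕ) (X : Fin n → Ω → ℝ) (φ : (Fin n → ℝ) → ℝ),
    (∀ i, X i ∈ H) → LocLipPoly φ → (fun ω => φ (fun i => X i ω)) ∈ H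
  mono : ∀ X ∈ H, ∀ Y ∈ H, (∀ ω, Y ω ≤ X ω) → E Y ≤ E X
  const : ∀ c : ℝ, E (fun _ => c) = (c : EReal)
  pos_homog : ∀ X ∈ H, ∀ c : ℝ, 0 ≤ c → E (fun ω => c * X ω) = (c : EReal) * E X
  subadd : ∀ X ∈ H, ∀ Y ∈ H, ¬ (E X = ⊤ ∧ E Y = ⊥) → ¬ (E X = ⊥ ∧ E Y = ⊤) →
    E (fun ω => X ω + Y ω) ≤ E X + E Y

namespace SublinearExpectation

/-- Countable sub-additivity: `E X ≤ ∑ E Xₙ` whenever `X ≤ ∑ Xₙ` with `X, Xₙ ∈ H` nonnegative. Both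
sums are sums of nonnegative terms and are taken in `[0, ∞]`. -/
def CountablySubadditive {Ω : Type*} [MeasurableSpace Ω] (S : SublinearExpectation Ω) : Prop :=
  ∀ (X : Ω → ℝ) (Z : ℕ → Ω → ℝ), X ∈ S.H → (∀ n, Z n ∈ S.H) →
    (∀ ω, 0 ≤ X ω) → (∀ n ω, 0 ≤ Z n ω) →
    (∀ ω, ENNReal.ofReal (X ω) ≤ ∑' n, ENNReal.ofReal (Z n ω)) →
    (S.E X).toENNReal ≤ ∑' n, (S.E (Z n)).toENNReal

/-- The upper capacity `V(A) = inf {E ξ : I_A ≤ ξ, ξ ∈ H}`. The infimum lies in `[0, 1]` for every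
measurable `A` (see `coe_capacity` and `capacity_le_one`), so it is recorded in `[0, ∞]`. -/
def capacity {Ω : Type*} [MeasurableSpace Ω] (S : SublinearExpectation Ω) (A : Set Ω) : ℝ≥0∞ :=
  (sInf (S.E '' {ξ | ξ ∈ S.H ∧ ∀ ω, A.indicator (fun _ => (1 : ℝ)) ω ≤ ξ ω})).toENNReal

theorem const_mem {Ω : Type*} [MeasurableSpace Ω] (S : SublinearExpectation Ω) (c : ℝ) :
    (fun _ : Ω => c) ∈ S.H :=
  S.comp_mem 0 (fun i => i.elim0) (fun _ => c) (fun i => i.elim0)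
    ⟨1, one_pos, 0, fun x y => by rw [sub_self, abs_zero]; positivity⟩

theorem coe_capacity {Ω : Type*} [MeasurableSpace Ω] (S : SublinearExpectation Ω) (A : Set Ω) :
    (S.capacity A : EReal) =
      sInf (S.E '' {ξ | ξ ∈ S.H ∧ ∀ ω, A.indicator (fun _ => (1 : ℝ)) ω ≤ ξ ω}) := by
  refine EReal.coe_toENNReal (le_sInf ?_)
  rintro _ ⟨ξ, ⟨hξ, hA⟩, rfl⟩
  have h := S.mono ξ hξ _ (S.const_mem 0)
    (fun ω => (Set.indicator_nonneg (fun _ _ => zero_le_one) ω).trans (hA ω))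
  rwa [S.const, EReal.coe_zero] at h

theorem capacity_le_one {Ω : Type*} [MeasurableSpace Ω] (S : SublinearExpectation Ω)
    (A : Set Ω) : S.capacity A ≤ 1 := by
  have h : (S.capacity A : EReal) ≤ ((1 : ℝ≥0∞) : EReal) := by
    rw [coe_capacity]
    refine sInf_le ⟨fun _ => 1, ⟨S.const_mem 1, fun ω => ?_⟩, by simp [S.const]⟩
    exact Set.indicator_le_self' (fun _ _ => zero_le_one) ω
  exact_mod_cast h

/-- The Choquet expectation
`C_V(X) = ∫_0^∞ V(X > x) dx + ∫_{-∞}^0 (V(X > x) - 1) dx ∈ [-∞, ∞]`. -/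
def choquet {Ω : Type*} [MeasurableSpace Ω] (S : SublinearExpectation Ω) (X : Ω → ℝ) : EReal :=
  ((∫⁻ x in Set.Ioi (0 : ℝ), S.capacity {ω | x < X ω} : ℝ≥0∞) : EReal) -
    ((∫⁻ x in Set.Iio (0 : ℝ), (1 - S.capacity {ω | x < X ω}) : ℝ≥0∞) : EReal)

/-- `Y` is independent of `X`: for each Borel `ψ` with `ψ(X, Y) ∈ H` and `ψ(x, Y) ∈ H` for all `x`,
`E[ψ(X, Y)] = E[E[ψ(x, Y)]|_{x = X}]` whenever `E|ψ(x, Y)| < ∞` for all `x` and the expectation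
of `E|ψ(x, Y)|` at `x = X` is finite. As `E` is defined on `H` only, the two functions of `X` whose
expectation is taken are required to lie in `H`. The numbers `E[ψ(x, Y)]`, `E|ψ(x, Y)|` are finite
here, so that `EReal.toReal` does not change them. -/
def IndepOf {Ω α β : Type*} [MeasurableSpace Ω] [MeasurableSpace α] [MeasurableSpace β]
    (S : SublinearExpectation Ω) (Y : Ω → β) (X : Ω → α) : Prop :=
  ∀ ψ : α × β → ℝ, Measurable ψ →
    (fun ω => ψ (X ω, Y ω)) ∈ S.H →
    (∀ x, (fun ω => ψ (x, Y ω)) ∈ S.H) →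
    (∀ x, S.E (fun ω => |ψ (x, Y ω)|) < ⊤) →
    (fun ω => (S.E (fun ω' => |ψ (X ω, Y ω')|)).toReal) ∈ S.H →
    S.E (fun ω => |(S.E (fun ω' => |ψ (X ω, Y ω')|)).toReal|) < ⊤ →
    (fun ω => (S.E (fun ω' => ψ (X ω, Y ω'))).toReal) ∈ S.H →
    S.E (fun ω => ψ (X ω, Y ω)) = S.E (fun ω => (S.E (fun ω' => ψ (X ω, Y ω'))).toReal)

/-- `X₁, X₂, …` is a sequence of independent random variables (the entry `X 0` plays no role):
`X_{n+1}` is independent of `(X₁, …, Xₙ)` for each `n ≥ 1`. -/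
def IndepSeq {Ω : Type*} [MeasurableSpace Ω] (S : SublinearExpectation Ω)
    (X : ℕ → Ω → ℝ) : Prop :=
  ∀ n : ℕ, 1 ≤ n → S.IndepOf (X (n + 1)) (fun ω (i : Fin n) => X (i + 1) ω)

/-- `X` and `Y` are identically distributed: `E[ψ(X)] = E[ψ(Y)]` for each Borel `ψ` with
`ψ(X), ψ(Y) ∈ H`, whenever these sublinear expectations are finite. -/
def IdentDistrib {Ω : Type*} [MeasurableSpace Ω] (S : SublinearExpectation Ω)
    (X Y : Ω → ℝ) : Prop :=
  ∀ ψ : ℝ → ℝ, Measurable ψ → (fun ω => ψ (X ω)) ∈ S.H → (fun ω => ψ (Y ω)) ∈ S.H →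
    S.E (fun ω => ψ (X ω)) ≠ ⊤ → S.E (fun ω => ψ (X ω)) ≠ ⊥ →
    S.E (fun ω => ψ (Y ω)) ≠ ⊤ → S.E (fun ω => ψ (Y ω)) ≠ ⊥ →
    S.E (fun ω => ψ (X ω)) = S.E (fun ω => ψ (Y ω))

end SublinearExpectation

/-- `a_{ni} ≈ b_{ni}`, `0 ≤ i ≤ n - 1`: there are constants `c, C > 0`, not depending on `n` and `i`,
with `c b_{ni} ≤ a_{ni} ≤ C b_{ni}` for all `n` large enough and all `0 ≤ i ≤ n - 1`. -/
def ArrayApprox (a b : ℕ → ℕ → ℝ) : Prop :=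
  ∃ c C : ℝ, 0 < c ∧ 0 < C ∧ ∃ N : ℕ, ∀ n ≥ N, ∀ i < n, c * b n i ≤ a n i ∧ a n i ≤ C * b n i

/-- `max_{0 ≤ j ≤ n - 1} |∑_{i=1}^{j} a_{ni} X_i|` for `n ≥ 1` (the empty sum, `j = 0`, is `0`). -/
def maxAbsWeightedSum {Ω : Type*} (a : ℕ → ℕ → ℝ) (X : ℕ → Ω → ℝ) (n : ℕ+) (ω : Ω) : ℝ :=
  (Finset.range n).sup' (Finset.nonempty_range_iff.2 n.ne_zero)
    (fun j => |∑ i ∈ Finset.Icc 1 j, a n i * X i ω|)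

end

/-! ### Bounded admissible variables, the capacity, and one-step independence. -/

noncomputable section

namespace SublinearExpectation

variable {Ω : Type*} [MeasurableSpace Ω] (S : SublinearExpectation Ω)

/-! Put k = n - i and α = p + β, so that a_{ni} is of order k^β n^{-α}. Both conditions are compared
with the series Σ_n n^{r-2} Σ_{1≤k<n} V(|X| > δ n^α k^{-β}), which records single terms a_{ni} X_i
of size about δ.

Series and moments. For fixed k, the n with n^α k^{-β} ≤ T carry total weight Σ n^{r-2} of order (T
k^β)^{(r-1)/α}, and k < n restricts k to at most a multiple of T^{1/p}. The weight of all pairs with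
threshold at most T is therefore of order T^{(r-1)/α} Σ_{k ≲ T^{1/p}} k^{β(r-1)/α}. The exponent of
k is below, equal to or above -1 according as β is below, equal to or above -p/r; this yields the
three functions collected in `momentFun`. Since V is not additive, series and integral cannot be
compared by Fubini over Ω. Instead V(Y > x) is written as the integral over s in (0,1) of the
indicator of s < V(Y > x), and for fixed s only monotonicity in x is needed
(`tsum_capacity_le_lintegral`, `lintegral_le_tsum_capacity`).

(i) implies (ii). Outside the events of one large term, all terms a_{ni} X_i may be truncated at a
level d proportional to ε. Truncated sums obey an exponential maximal inequality
(`capacity_exists_sum_le`), obtained from Ville's inequality for stopped products. The moment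
condition bounds truncated means and second moments by powers A^s of the weights with p s > 1, whose
sums over i decay like a negative power of n (`exists_sum_weight_rpow_le`). An exponential parameter
proportional to ln n then gives O(n^{-r}), and n^{r-2} n^{-r} is summable.

(ii) implies (i). A term of modulus above cδ is a difference of two partial sums, so the maximum
exceeds cδ/2. Independence bounds the capacity of this event from below by 1 - exp(-u_n), with u_n
the inner sum of the series. Summability against n^{r-2}, with a comparison of u_n and u_m for n < m
≤ 2n, forces u_n ≤ 1/2 eventually; there u ≤ 2(1 - e^{-u}), so the series converges. -/

theorem add_mem {X Y : Ω → ℝ} (hX : X ∈ S.H) (hY : Y ∈ S.H) :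
    (fun ω => X ω + Y ω) ∈ S.H := by
  refine S.comp_mem 2 ![X, Y] (fun x => x 0 + x 1) ?_ ⟨2, two_pos, 0, fun x y => ?_⟩
  · intro i; fin_cases i <;> assumption
  · have h0 := norm_le_pi_norm (x - y) 0
    have h1 := norm_le_pi_norm (x - y) 1
    simp only [Pi.sub_apply, Real.norm_eq_abs] at h0 h1
    have h2 := abs_add_le (x 0 - y 0) (x 1 - y 1)
    have h3 : x 0 + x 1 - (y 0 + y 1) = (x 0 - y 0) + (x 1 - y 1) := by ring
    have h4 := norm_nonneg (x - y)
    rw [h3, pow_zero, pow_zero]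
    linarith

theorem mul_mem {X Y : Ω → ℝ} (hX : X ∈ S.H) (hY : Y ∈ S.H) :
    (fun ω => X ω * Y ω) ∈ S.H := by
  refine S.comp_mem 2 ![X, Y] (fun x => x 0 * x 1) ?_ ⟨1, one_pos, 1, fun x y => ?_⟩
  · intro i; fin_cases i <;> assumption
  · have h0 := norm_le_pi_norm (x - y) 0
    have h1 := norm_le_pi_norm (x - y) 1
    have h2 := norm_le_pi_norm x 0
    have h3 := norm_le_pi_norm y 1
    simp only [Pi.sub_apply, Real.norm_eq_abs] at h0 h1 h2 h3
    have h5 : x 0 * x 1 - y 0 * y 1 = x 0 * (x 1 - y 1) + (x 0 - y 0) * y 1 := by ring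
    have h4 := norm_nonneg (x - y)
    rw [h5, pow_one, pow_one]
    refine (abs_add_le _ _).trans ?_
    rw [abs_mul, abs_mul]
    have h6 : |x 0| * |x 1 - y 1| ≤ ‖x‖ * ‖x - y‖ := by gcongr
    have h7 : |x 0 - y 0| * |y 1| ≤ ‖x - y‖ * ‖y‖ := by gcongr
    nlinarith

theorem const_mul_mem {X : Ω → ℝ} (c : ℝ) (hX : X ∈ S.H) : (fun ω => c * X ω) ∈ S.H :=
  S.mul_mem (S.const_mem c) hX

theorem lipschitz_comp_mem {f : ℝ → ℝ} (hf : LipschitzWith 1 f) {X : Ω → ℝ} (hX : X ∈ S.H) :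
    (fun ω => f (X ω)) ∈ S.H := by
  refine S.comp_mem 1 (fun _ => X) (fun x => f (x 0)) (fun _ => hX)
    ⟨1, one_pos, 0, fun x y => ?_⟩
  have h0 := norm_le_pi_norm (x - y) 0
  have h1 := hf.dist_le_mul (x 0) (y 0)
  have h4 := norm_nonneg (x - y)
  simp only [Pi.sub_apply, Real.norm_eq_abs, Real.dist_eq, NNReal.coe_one, one_mul] at h0 h1
  rw [pow_zero, pow_zero]
  linarith

/-- Bounded admissible random variables. -/
def IsBdd (ξ : Ω → ℝ) : Prop := ξ ∈ S.H ∧ ∃ M : ℝ, ∀ ω, |ξ ω| ≤ M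

/-- The sublinear expectation of a bounded admissible random variable, as a real number. -/
def ev (ξ : Ω → ℝ) : ℝ := (S.E ξ).toReal

variable {S}

theorem IsBdd.add {X Y : Ω → ℝ} (hX : S.IsBdd X) (hY : S.IsBdd Y) :
    S.IsBdd (fun ω => X ω + Y ω) := by
  obtain ⟨hX, M, hM⟩ := hX
  obtain ⟨hY, N, hN⟩ := hY
  exact ⟨S.add_mem hX hY, M + N, fun ω => (abs_add_le _ _).trans (add_le_add (hM ω) (hN ω))⟩

theorem IsBdd.mul {X Y : Ω → ℝ} (hX : S.IsBdd X) (hY : S.IsBdd Y) :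
    S.IsBdd (fun ω => X ω * Y ω) := by
  obtain ⟨hX, M, hM⟩ := hX
  obtain ⟨hY, N, hN⟩ := hY
  refine ⟨S.mul_mem hX hY, M * N, fun ω => ?_⟩
  rw [abs_mul]
  exact mul_le_mul (hM ω) (hN ω) (abs_nonneg _) ((abs_nonneg _).trans (hM ω))

theorem isBdd_const (c : ℝ) : S.IsBdd (fun _ => c) := ⟨S.const_mem c, |c|, fun _ => le_rfl⟩

theorem isBdd_indicator {A : Set Ω} (hA : MeasurableSet A) :
    S.IsBdd (A.indicator (fun _ => (1 : ℝ))) := by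
  refine ⟨S.indicator_mem A hA, 1, fun ω => ?_⟩
  by_cases h : ω ∈ A <;> simp [h]

theorem IsBdd.coe_ev {ξ : Ω → ℝ} (h : S.IsBdd ξ) : ((S.ev ξ : ℝ) : EReal) = S.E ξ := by
  obtain ⟨h, M, hM⟩ := h
  have h1 := S.mono _ (S.const_mem M) ξ h (fun ω => (le_abs_self _).trans (hM ω))
  have h2 := S.mono ξ h _ (S.const_mem (-M)) (fun ω => neg_le_of_abs_le (hM ω))
  rw [S.const] at h1 h2
  refine EReal.coe_toReal (fun h => ?_) (fun h => ?_)
  · rw [h] at h1; exact absurd h1 (by simp)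
  · rw [h] at h2; exact absurd h2 (by simp)

theorem ev_mono {ξ η : Ω → ℝ} (h : S.IsBdd ξ) (h' : S.IsBdd η) (hle : ∀ ω, ξ ω ≤ η ω) :
    S.ev ξ ≤ S.ev η := by
  rw [← EReal.coe_le_coe_iff, h.coe_ev, h'.coe_ev]
  exact S.mono _ h'.1 _ h.1 hle

theorem ev_const (c : ℝ) : S.ev (fun _ => c) = c := by
  rw [ev, S.const, EReal.toReal_coe]

theorem ev_nonneg {ξ : Ω → ℝ} (h : S.IsBdd ξ) (h0 : ∀ ω, 0 ≤ ξ ω) : 0 ≤ S.ev ξ := by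
  rw [← ev_const (S := S) 0]
  exact ev_mono (isBdd_const 0) h h0

theorem ev_add_le {ξ η : Ω → ℝ} (h : S.IsBdd ξ) (h' : S.IsBdd η) :
    S.ev (fun ω => ξ ω + η ω) ≤ S.ev ξ + S.ev η := by
  rw [← EReal.coe_le_coe_iff, (h.add h').coe_ev, EReal.coe_add, h.coe_ev, h'.coe_ev]
  refine S.subadd _ h.1 _ h'.1 ?_ ?_ <;> rw [← h.coe_ev, ← h'.coe_ev] <;> simp

theorem ev_const_mul {ξ : Ω → ℝ} (h : S.IsBdd ξ) {c : ℝ} (hc : 0 ≤ c) :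
    S.ev (fun ω => c * ξ ω) = c * S.ev ξ := by
  rw [← EReal.coe_eq_coe_iff, ((isBdd_const c).mul h).coe_ev, EReal.coe_mul, h.coe_ev,
    S.pos_homog _ h.1 _ hc]

/-- Although the expectation is only sub-additive, constants come out exactly: the reverse
inequality is sub-additivity applied after adding -c. -/
theorem ev_const_add {ξ : Ω → ℝ} (h : S.IsBdd ξ) (c : ℝ) :
    S.ev (fun ω => c + ξ ω) = c + S.ev ξ := by
  apply le_antisymm
  · have := ev_add_le (isBdd_const (S := S) c) h
    rwa [ev_const] at this
  · have := ev_add_le (isBdd_const (S := S) (-c)) ((isBdd_const c).add h)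
    rw [ev_const] at this
    simp only [neg_add_cancel_left] at this
    linarith

theorem capacity_mono {A B : Set Ω} (h : A ⊆ B) : S.capacity A ≤ S.capacity B := by
  refine EReal.toENNReal_le_toENNReal (sInf_le_sInf (Set.image_mono ?_))
  rintro ξ ⟨hξ, hB⟩
  exact ⟨hξ, fun ω => (Set.indicator_le_indicator_of_subset h (fun _ => zero_le_one) ω).trans (hB ω)⟩

theorem capacity_eq {A : Set Ω} (hA : MeasurableSet A) :
    S.capacity A = ENNReal.ofReal (S.ev (A.indicator (fun _ => (1 : ℝ)))) := by
  have h : sInf (S.E '' {ξ | ξ ∈ S.H ∧ ∀ ω, A.indicator (fun _ => (1 : ℝ)) ω ≤ ξ ω})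
      = S.E (A.indicator (fun _ => (1 : ℝ))) := by
    refine le_antisymm (sInf_le ⟨_, ⟨S.indicator_mem A hA, fun _ => le_rfl⟩, rfl⟩) (le_sInf ?_)
    rintro _ ⟨ξ, ⟨hξ, h⟩, rfl⟩
    exact S.mono _ hξ _ (S.indicator_mem A hA) h
  rw [capacity, h, ← (isBdd_indicator hA).coe_ev, EReal.toENNReal_of_ne_top (EReal.coe_ne_top _),
    EReal.toReal_coe]

theorem capacity_univ : S.capacity Set.univ = 1 := by
  rw [capacity_eq MeasurableSet.univ, Set.indicator_univ, ev_const, ENNReal.ofReal_one]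

theorem capacity_empty : S.capacity ∅ = 0 := by
  rw [capacity_eq MeasurableSet.empty, Set.indicator_empty, ev_const, ENNReal.ofReal_zero]

theorem capacity_ne_top (A : Set Ω) : S.capacity A ≠ ⊤ :=
  ((S.capacity_le_one A).trans_lt ENNReal.one_lt_top).ne

theorem capacity_union_le {A B : Set Ω} (hA : MeasurableSet A) (hB : MeasurableSet B) :
    S.capacity (A ∪ B) ≤ S.capacity A + S.capacity B := by
  have h1 := isBdd_indicator (S := S) hA
  have h2 := isBdd_indicator (S := S) hB
  have ha := ev_nonneg h1 (fun ω => Set.indicator_nonneg (fun _ _ => zero_le_one) ω)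
  have hb := ev_nonneg h2 (fun ω => Set.indicator_nonneg (fun _ _ => zero_le_one) ω)
  rw [capacity_eq (hA.union hB), capacity_eq hA, capacity_eq hB, ← ENNReal.ofReal_add ha hb]
  refine ENNReal.ofReal_le_ofReal (le_trans ?_ (ev_add_le h1 h2))
  refine ev_mono (isBdd_indicator (hA.union hB)) (h1.add h2) (fun ω => ?_)
  by_cases h : ω ∈ A <;> by_cases h' : ω ∈ B <;> simp [h, h']

theorem capacity_biUnion_le {ι : Type*} (s : Finset ι) {A : ι → Set Ω}
    (hA : ∀ i ∈ s, MeasurableSet (A i)) :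
    S.capacity (⋃ i ∈ s, A i) ≤ ∑ i ∈ s, S.capacity (A i) := by
  classical
  induction s using Finset.induction_on with
  | empty => simp [capacity_empty]
  | insert i s hi ih =>
    rw [Finset.set_biUnion_insert, Finset.sum_insert hi]
    refine (capacity_union_le (hA i (by simp)) (s.measurableSet_biUnion
      fun j hj => hA j (by simp [hj]))).trans ?_
    gcongr
    exact ih fun j hj => hA j (by simp [hj])

/-- Markov's inequality, with the domination on `A` and the nonnegativity off `A` merged into one
pointwise bound. -/
theorem mul_capacity_le {A : Set Ω} (hA : MeasurableSet A) {ξ : Ω → ℝ} (hξ : S.IsBdd ξ) {t : ℝ}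
    (ht : 0 < t) (h : ∀ ω, t * A.indicator (fun _ => (1 : ℝ)) ω ≤ ξ ω) :
    S.capacity A ≤ ENNReal.ofReal (S.ev ξ / t) := by
  rw [capacity_eq hA]
  refine ENNReal.ofReal_le_ofReal ?_
  rw [le_div_iff₀ ht, mul_comm, ← ev_const_mul (isBdd_indicator hA) ht.le]
  exact ev_mono ((isBdd_const t).mul (isBdd_indicator hA)) hξ h

theorem IdentDistrib.ev_eq {X Y : Ω → ℝ} (h : S.IdentDistrib X Y) {f : ℝ → ℝ} (hf : Measurable f)
    (hX : S.IsBdd (fun ω => f (X ω))) (hY : S.IsBdd (fun ω => f (Y ω))) :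
    S.ev (fun ω => f (X ω)) = S.ev (fun ω => f (Y ω)) := by
  have := h f hf hX.1 hY.1
  rw [← hX.coe_ev, ← hY.coe_ev] at this
  simpa using this

theorem IdentDistrib.capacity_preimage_eq {X Y : Ω → ℝ} (h : S.IdentDistrib X Y)
    (hX : Measurable X) (hY : Measurable Y) {B : Set ℝ} (hB : MeasurableSet B) :
    S.capacity (X ⁻¹' B) = S.capacity (Y ⁻¹' B) := by
  rw [capacity_eq (hX hB), capacity_eq (hY hB)]
  exact congrArg _ (h.ev_eq (f := B.indicator fun _ => 1) (measurable_const.indicator hB)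
    (isBdd_indicator (hX hB)) (isBdd_indicator (hY hB)))

/-- For `Y` independent of `X`, the variable `Y` may be integrated out in `g(X) + h(X) ξ(Y)`. -/
theorem IndepOf.ev_add_mul {α β : Type*} [MeasurableSpace α] [MeasurableSpace β]
    {Y : Ω → β} {X : Ω → α} (hind : S.IndepOf Y X) {g h : α → ℝ} {ξ : β → ℝ}
    (hg : Measurable g) (hh : Measurable h) (hξ : Measurable ξ)
    (hgX : S.IsBdd (fun ω => g (X ω))) (hhX : S.IsBdd (fun ω => h (X ω)))
    (hξY : S.IsBdd (fun ω => ξ (Y ω))) (hg0 : ∀ x, 0 ≤ g x) (hh0 : ∀ x, 0 ≤ h x)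
    (hξ0 : ∀ y, 0 ≤ ξ y) :
    S.ev (fun ω => g (X ω) + h (X ω) * ξ (Y ω)) =
      S.ev (fun ω => g (X ω) + h (X ω) * S.ev (fun ω => ξ (Y ω))) := by
  set e := S.ev (fun ω => ξ (Y ω)) with he
  have he0 : 0 ≤ e := ev_nonneg hξY fun ω => hξ0 _
  -- Nonnegativity makes |ψ| = ψ, and the inner expectation is g + h e. All side conditions in
  -- `IndepOf` thus reduce to admissibility of sums and products.
  have habs : ∀ x y, |g x + h x * ξ y| = g x + h x * ξ y := fun x y =>
    abs_of_nonneg (add_nonneg (hg0 x) (mul_nonneg (hh0 x) (hξ0 y)))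
  have hx : ∀ x, S.IsBdd (fun ω => g x + h x * ξ (Y ω)) := fun x =>
    (isBdd_const (g x)).add ((isBdd_const (h x)).mul hξY)
  have hv : ∀ x, (S.E (fun ω => g x + h x * ξ (Y ω))).toReal = g x + h x * e := by
    intro x
    change S.ev _ = _
    rw [ev_const_add ((isBdd_const (h x)).mul hξY), ev_const_mul hξY (hh0 x)]
  have hr : S.IsBdd (fun ω => g (X ω) + h (X ω) * e) := hgX.add (hhX.mul (isBdd_const e))
  have hl : S.IsBdd (fun ω => g (X ω) + h (X ω) * ξ (Y ω)) := hgX.add (hhX.mul hξY)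
  have key := hind (fun z => g z.1 + h z.1 * ξ z.2)
    ((hg.comp measurable_fst).add ((hh.comp measurable_fst).mul (hξ.comp measurable_snd)))
    hl.1 (fun x => (hx x).1)
  simp only [habs, hv] at key
  rw [ev, ev, key]
  · intro x
    rw [← (hx x).coe_ev]; exact EReal.coe_lt_top _
  · exact hr.1
  · have : (fun ω => |g (X ω) + h (X ω) * e|) = fun ω => g (X ω) + h (X ω) * e := by
      funext ω
      exact abs_of_nonneg (add_nonneg (hg0 _) (mul_nonneg (hh0 _) he0))
    rw [this, ← hr.coe_ev]; exact EReal.coe_lt_top _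
  · exact hr.1

/-- The tuple `(X₁, …, Xₘ)`. -/
def tuple (X : ℕ → Ω → ℝ) (m : ℕ) (ω : Ω) (i : Fin m) : ℝ := X (i + 1) ω

theorem IndepSeq.ev_add_mul {X : ℕ → Ω → ℝ} (hind : S.IndepSeq X) (m : ℕ)
    {g h : (Fin m → ℝ) → ℝ} {ξ : ℝ → ℝ}
    (hg : Measurable g) (hh : Measurable h) (hξ : Measurable ξ)
    (hgX : S.IsBdd (fun ω => g (tuple X m ω))) (hhX : S.IsBdd (fun ω => h (tuple X m ω)))
    (hξY : S.IsBdd (fun ω => ξ (X (m + 1) ω))) (hg0 : ∀ x, 0 ≤ g x) (hh0 : ∀ x, 0 ≤ h x)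
    (hξ0 : ∀ y, 0 ≤ ξ y) :
    S.ev (fun ω => g (tuple X m ω) + h (tuple X m ω) * ξ (X (m + 1) ω)) =
      S.ev (fun ω => g (tuple X m ω) + h (tuple X m ω) * S.ev (fun ω => ξ (X (m + 1) ω))) := by
  -- `IndepSeq` starts at length 1; for the empty tuple g and h are constants and no independence is
  -- needed.
  rcases Nat.eq_zero_or_pos m with rfl | hm
  · have ht : ∀ ω, tuple X 0 ω = Fin.elim0 := fun ω => Subsingleton.elim _ _
    simp only [ht]
    rw [ev_const_add ((isBdd_const _).mul hξY), ev_const_mul hξY (hh0 _), ev_const]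
  · exact (hind m hm).ev_add_mul hg hh hξ hgX hhX hξY hg0 hh0 hξ0

end SublinearExpectation
end

/-! ### Maximal inequalities and a lower bound for unions of independent events. -/

noncomputable section

namespace SublinearExpectation

variable {Ω : Type*} [MeasurableSpace Ω] {S : SublinearExpectation Ω}

theorem measurable_tuple {X : ℕ → Ω → ℝ} (hX : ∀ n, 1 ≤ n → X n ∈ S.H) (m : ℕ) :
    Measurable (tuple X m) :=
  measurable_pi_lambda _ fun i => S.measurable_of_mem _ (hX _ (Nat.succ_pos i))

/-- The tuple without its last entry. -/
def dropLast {m : ℕ} (x : Fin (m + 1) → ℝ) (i : Fin m) : ℝ := x i.castSucc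

theorem measurable_dropLast (m : ℕ) : Measurable (dropLast (m := m)) :=
  measurable_pi_lambda _ fun i => measurable_pi_apply (Fin.castSucc i)

/-- The product process stopped when it first exceeds `t`, as a function of `(X₁, …, Xₘ)`. -/
theorem IndepSeq.exists_stopped_prod {X : ℕ → Ω → ℝ} (hind : S.IndepSeq X)
    (hX : ∀ n, 1 ≤ n → X n ∈ S.H) {ξ : ℕ → ℝ → ℝ} (hξ : ∀ n, Measurable (ξ n))
    (hξ0 : ∀ n y, 0 ≤ ξ n y) (hb : ∀ n, 1 ≤ n → S.IsBdd (fun ω => ξ n (X n ω)))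
    (he : ∀ n, 1 ≤ n → S.ev (fun ω => ξ n (X n ω)) ≤ 1) (t : ℝ) (m : ℕ) :
    ∃ φ : (Fin m → ℝ) → ℝ, Measurable φ ∧ (∀ x, 0 ≤ φ x) ∧ S.IsBdd (fun ω => φ (tuple X m ω)) ∧
      S.ev (fun ω => φ (tuple X m ω)) ≤ 1 ∧
      ∀ ω, t < φ (tuple X m ω) ∨
        φ (tuple X m ω) = ∏ i ∈ Finset.Icc 1 m, ξ i (X i ω) ∧
          ∀ j ≤ m, ∏ i ∈ Finset.Icc 1 j, ξ i (X i ω) ≤ t := by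
  induction m with
  | zero =>
    -- The value at j = 0 is the empty product 1, which already exceeds t when t < 1.
    by_cases ht : t < 1
    · exact ⟨fun _ => 1, measurable_const, fun _ => zero_le_one, isBdd_const 1, (ev_const 1).le,
        fun ω => Or.inl ht⟩
    · exact ⟨fun _ => 1, measurable_const, fun _ => zero_le_one, isBdd_const 1, (ev_const 1).le,
        fun ω => Or.inr ⟨by simp, fun j hj => by
          obtain rfl : j = 0 := by omega
          simpa using ht⟩⟩
  | succ m ih =>
    obtain ⟨φ, hφ, hφ0, hφb, hφe, hφs⟩ := ih
    set A : Set (Fin m → ℝ) := {x | t < φ x} with hA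
    have hAm : MeasurableSet A := measurableSet_lt measurable_const hφ
    set IA : (Fin m → ℝ) → ℝ := A.indicator fun _ => 1 with hIA
    set IB : (Fin m → ℝ) → ℝ := Aᶜ.indicator fun _ => 1 with hIB
    have hIAm : Measurable IA := measurable_const.indicator hAm
    have hIBm : Measurable IB := measurable_const.indicator hAm.compl
    have hIA0 : ∀ x, 0 ≤ IA x := fun x => Set.indicator_nonneg (fun _ _ => zero_le_one) x
    have hIB0 : ∀ x, 0 ≤ IB x := fun x => Set.indicator_nonneg (fun _ _ => zero_le_one) x
    have hIAb : S.IsBdd (fun ω => IA (tuple X m ω)) :=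
      isBdd_indicator (S := S) (measurable_tuple hX m hAm)
    have hIBb : S.IsBdd (fun ω => IB (tuple X m ω)) :=
      isBdd_indicator (S := S) (measurable_tuple hX m hAm.compl)
    have hsum : ∀ x, φ x * IA x + φ x * IB x = φ x := fun x => by
      by_cases h : x ∈ A <;> simp [hIA, hIB, h]
    have hm1 : 1 ≤ m + 1 := Nat.succ_pos m
    have hgb := hφb.mul hIAb
    have hhb := hφb.mul hIBb
    -- On `A` the process has passed t and is frozen; on the complement it is multiplied by the next
    -- factor. Integrating out that factor, of expectation at most 1, does not increase the
    -- expectation.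
    refine ⟨fun x => φ (dropLast x) * IA (dropLast x) +
        φ (dropLast x) * IB (dropLast x) * ξ (m + 1) (x (Fin.last m)), ?_, ?_, ?_, ?_, ?_⟩
    · have hi := measurable_dropLast m
      exact ((hφ.comp hi).mul (hIAm.comp hi)).add (((hφ.comp hi).mul (hIBm.comp hi)).mul
        ((hξ _).comp (measurable_pi_apply _)))
    · exact fun x => add_nonneg (mul_nonneg (hφ0 _) (hIA0 _))
        (mul_nonneg (mul_nonneg (hφ0 _) (hIB0 _)) (hξ0 _ _))
    · exact hgb.add (hhb.mul (hb _ hm1))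
    · have key := hind.ev_add_mul m (g := fun x => φ x * IA x) (h := fun x => φ x * IB x)
        (hφ.mul hIAm) (hφ.mul hIBm) (hξ (m + 1)) hgb hhb (hb _ hm1)
        (fun x => mul_nonneg (hφ0 _) (hIA0 _)) (fun x => mul_nonneg (hφ0 _) (hIB0 _)) (hξ0 _)
      refine key.le.trans (le_trans ?_ hφe)
      refine ev_mono (hgb.add (hhb.mul (isBdd_const _))) hφb fun ω => ?_
      have h1 := hsum (tuple X m ω)
      have h2 := mul_le_mul_of_nonneg_left (he _ hm1)
        (mul_nonneg (hφ0 (tuple X m ω)) (hIB0 (tuple X m ω)))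
      linarith
    · intro ω
      change t < φ (tuple X m ω) * IA (tuple X m ω) +
        φ (tuple X m ω) * IB (tuple X m ω) * ξ (m + 1) (X (m + 1) ω) ∨
        φ (tuple X m ω) * IA (tuple X m ω) +
        φ (tuple X m ω) * IB (tuple X m ω) * ξ (m + 1) (X (m + 1) ω) = _ ∧ _
      by_cases h : t < φ (tuple X m ω)
      · left
        have h' : tuple X m ω ∈ A := h
        simpa [hIA, hIB, h'] using h
      · have h' : tuple X m ω ∉ A := h
        obtain ⟨h1, h2⟩ := (hφs ω).resolve_left h
        have h3 : φ (tuple X m ω) * IA (tuple X m ω) +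
            φ (tuple X m ω) * IB (tuple X m ω) * ξ (m + 1) (X (m + 1) ω) =
            ∏ i ∈ Finset.Icc 1 (m + 1), ξ i (X i ω) := by
          rw [Finset.prod_Icc_succ_top hm1, ← h1]
          simp [hIA, hIB, h']
        rw [h3]
        by_cases h4 : t < ∏ i ∈ Finset.Icc 1 (m + 1), ξ i (X i ω)
        · exact Or.inl h4
        · refine Or.inr ⟨rfl, fun j hj => ?_⟩
          rcases Nat.lt_or_ge m j with hj' | hj'
          · obtain rfl : j = m + 1 := by omega
            exact not_lt.1 h4
          · exact h2 j hj'

theorem measurableSet_exists_le_lt {f : ℕ → Ω → ℝ} (hf : ∀ j, Measurable (f j)) (m : ℕ) (t : ℝ) :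
    MeasurableSet {ω | ∃ j ≤ m, t < f j ω} := by
  have : {ω | ∃ j ≤ m, t < f j ω} = ⋃ j, ⋃ _ : j ≤ m, {ω | t < f j ω} := by
    ext ω; simp
  rw [this]
  exact .iUnion fun j => .iUnion fun _ => measurableSet_lt measurable_const (hf j)

/-- Ville's maximal inequality for products of independent nonnegative factors. -/
theorem IndepSeq.capacity_exists_prod_le {X : ℕ → Ω → ℝ} (hind : S.IndepSeq X)
    (hX : ∀ n, 1 ≤ n → X n ∈ S.H) {ξ : ℕ → ℝ → ℝ} (hξ : ∀ n, Measurable (ξ n))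
    (hξ0 : ∀ n y, 0 ≤ ξ n y) (hb : ∀ n, 1 ≤ n → S.IsBdd (fun ω => ξ n (X n ω)))
    (he : ∀ n, 1 ≤ n → S.ev (fun ω => ξ n (X n ω)) ≤ 1) {t : ℝ} (ht : 0 < t) (m : ℕ) :
    S.capacity {ω | ∃ j ≤ m, t < ∏ i ∈ Finset.Icc 1 j, ξ i (X i ω)} ≤ ENNReal.ofReal (1 / t) := by
  obtain ⟨φ, hφ, hφ0, hφb, hφe, hφs⟩ := hind.exists_stopped_prod hX hξ hξ0 hb he t m
  have hA : MeasurableSet {ω | ∃ j ≤ m, t < ∏ i ∈ Finset.Icc 1 j, ξ i (X i ω)} := by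
    refine measurableSet_exists_le_lt (fun j => ?_) m t
    exact Finset.measurable_prod _ fun i hi =>
      (hξ i).comp (S.measurable_of_mem _ (hX _ (Finset.mem_Icc.1 hi).1))
  refine (mul_capacity_le hA hφb ht fun ω => ?_).trans
    (ENNReal.ofReal_le_ofReal (div_le_div_of_nonneg_right hφe ht.le))
  by_cases h : ∃ j ≤ m, t < ∏ i ∈ Finset.Icc 1 j, ξ i (X i ω)
  · rw [Set.indicator_of_mem (by exact h), mul_one]
    rcases hφs ω with h1 | ⟨-, h1⟩
    · exact h1.le
    · obtain ⟨j, hj, h2⟩ := h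
      exact absurd h2 (not_lt.2 (h1 j hj))
  · rw [Set.indicator_of_notMem (by exact h), mul_zero]
    exact hφ0 _

/-- A quadratic majorant of the exponential: its expectation is controlled by first and second
moments alone, and it stays within sums and products of admissible variables. -/
theorem exp_le_one_add_add_sq (u : ℝ) {c : ℝ} (hu : |u| ≤ c) :
    Real.exp u ≤ 1 + u + Real.exp c * u ^ 2 := by
  have hc : 0 ≤ c := (abs_nonneg u).trans hu
  have h1 : 1 ≤ Real.exp c := Real.one_le_exp hc
  rcases le_total |u| 1 with h | h
  · have := Real.abs_exp_sub_one_sub_id_le h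
    have := (abs_le.1 this).2
    nlinarith [sq_nonneg u]
  · have h2 : 1 ≤ u ^ 2 := by rw [← sq_abs]; nlinarith
    rcases le_total 0 u with h3 | h3
    · have : Real.exp u ≤ Real.exp c := Real.exp_le_exp.2 ((le_abs_self u).trans hu)
      nlinarith
    · rw [abs_of_nonpos h3] at h
      have : Real.exp u ≤ 1 := Real.exp_le_one_iff.2 h3
      nlinarith

/-- An exponential maximal inequality for sums of bounded independent variables. -/
theorem IndepSeq.capacity_exists_sum_le {X : ℕ → Ω → ℝ} (hind : S.IndepSeq X)
    (hX : ∀ n, 1 ≤ n → X n ∈ S.H) {Z : ℕ → ℝ → ℝ} (hZ : ∀ n, Measurable (Z n)) {d : ℝ}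
    (hd : ∀ n y, |Z n y| ≤ d) (hb : ∀ n, 1 ≤ n → (fun ω => Z n (X n ω)) ∈ S.H)
    {μ σ : ℕ → ℝ} (hμ : ∀ n, 1 ≤ n → S.ev (fun ω => Z n (X n ω)) ≤ μ n)
    (hσ : ∀ n, 1 ≤ n → S.ev (fun ω => Z n (X n ω) ^ 2) ≤ σ n)
    (hμ0 : ∀ n, 0 ≤ μ n) (hσ0 : ∀ n, 0 ≤ σ n) {l : ℝ} (hl0 : 0 < l) (ε : ℝ) (m : ℕ) :
    S.capacity {ω | ∃ j ≤ m, ε < ∑ i ∈ Finset.Icc 1 j, Z i (X i ω)} ≤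
      ENNReal.ofReal (Real.exp (-l * ε + l * ∑ i ∈ Finset.Icc 1 m, μ i +
        l ^ 2 * Real.exp (l * d) * ∑ i ∈ Finset.Icc 1 m, σ i)) := by
  have hl := hl0.le
  set L := Real.exp (l * d) with hL
  set κ : ℕ → ℝ := fun i => l * μ i + l ^ 2 * L * σ i with hκ
  have hL0 : 0 ≤ l ^ 2 * L := by positivity
  have hκ0 : ∀ i, 0 ≤ κ i := fun i => add_nonneg (mul_nonneg hl (hμ0 i)) (mul_nonneg hL0 (hσ0 i))
  have hκs : ∑ i ∈ Finset.Icc 1 m, κ i = l * ∑ i ∈ Finset.Icc 1 m, μ i +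
      l ^ 2 * L * ∑ i ∈ Finset.Icc 1 m, σ i := by
    rw [Finset.mul_sum, Finset.mul_sum, ← Finset.sum_add_distrib]
  have hexp : ∀ i y, Real.exp (l * Z i y) ≤ 1 + (l * Z i y + l ^ 2 * L * Z i y ^ 2) := by
    intro i y
    have := exp_le_one_add_add_sq (l * Z i y) (c := l * d) (by
      rw [abs_mul, abs_of_nonneg hl]; exact mul_le_mul_of_nonneg_left (hd i y) hl)
    rw [← hL] at this
    linarith [show l ^ 2 * L * Z i y ^ 2 = L * (l * Z i y) ^ 2 by ring]
  -- The factor dominates exp(l Z - κ), and κ is chosen so that its expectation is at most e^{-κ}(1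
  -- + κ) ≤ 1. Ville's inequality at level exp(lε - Σκ) then gives the claim.
  set ξ : ℕ → ℝ → ℝ := fun i y =>
    Real.exp (-κ i) * (1 + (l * Z i y + l ^ 2 * L * Z i y ^ 2)) with hξdef
  have hξe : ∀ i y, Real.exp (l * Z i y - κ i) ≤ ξ i y := by
    intro i y
    rw [sub_eq_neg_add, Real.exp_add]
    exact mul_le_mul_of_nonneg_left (hexp i y) (Real.exp_pos _).le
  have hZb : ∀ n, 1 ≤ n → S.IsBdd (fun ω => Z n (X n ω)) := fun n hn =>
    ⟨hb n hn, d, fun ω => hd n _⟩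
  have hZ2 : ∀ n, 1 ≤ n → S.IsBdd (fun ω => Z n (X n ω) ^ 2) := fun n hn => by
    simpa [sq] using (hZb n hn).mul (hZb n hn)
  have h1 : ∀ n, 1 ≤ n → S.IsBdd (fun ω => l * Z n (X n ω)) := fun n hn =>
    (isBdd_const l).mul (hZb n hn)
  have h2 : ∀ n, 1 ≤ n → S.IsBdd (fun ω => l ^ 2 * L * Z n (X n ω) ^ 2) := fun n hn =>
    (isBdd_const _).mul (hZ2 n hn)
  have h3 : ∀ n, 1 ≤ n → S.IsBdd
      (fun ω => 1 + (l * Z n (X n ω) + l ^ 2 * L * Z n (X n ω) ^ 2)) := fun n hn =>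
    (isBdd_const 1).add ((h1 n hn).add (h2 n hn))
  have key := hind.capacity_exists_prod_le hX (ξ := ξ)
    (fun n => by have := hZ n; fun_prop)
    (fun n y => (Real.exp_pos _).le.trans (hξe n y))
    (fun n hn => (isBdd_const _).mul (h3 n hn))
    (fun n hn => ?_) (t := Real.exp (l * ε - ∑ i ∈ Finset.Icc 1 m, κ i)) (Real.exp_pos _) m
  · refine (capacity_mono ?_).trans (key.trans (le_of_eq ?_))
    · rintro ω ⟨j, hj, h⟩
      refine ⟨j, hj, ?_⟩
      calc Real.exp (l * ε - ∑ i ∈ Finset.Icc 1 m, κ i)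
          < Real.exp (∑ i ∈ Finset.Icc 1 j, (l * Z i (X i ω) - κ i)) := by
            rw [Real.exp_lt_exp, Finset.sum_sub_distrib, ← Finset.mul_sum]
            have h5 : ∑ i ∈ Finset.Icc 1 j, κ i ≤ ∑ i ∈ Finset.Icc 1 m, κ i :=
              Finset.sum_le_sum_of_subset_of_nonneg (Finset.Icc_subset_Icc_right hj)
                fun i _ _ => hκ0 i
            have h6 := mul_lt_mul_of_pos_left h hl0
            linarith
        _ ≤ _ := by
            rw [Real.exp_sum]
            exact Finset.prod_le_prod (fun i _ => (Real.exp_pos _).le) fun i _ => hξe i _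
    · rw [one_div, ← Real.exp_neg, hκs]
      congr 2
      ring
  · change S.ev (fun ω => Real.exp (-κ n) * _) ≤ 1
    rw [ev_const_mul (h3 n hn) (Real.exp_pos _).le, ev_const_add ((h1 n hn).add (h2 n hn))]
    have h4 := ev_add_le (h1 n hn) (h2 n hn)
    rw [ev_const_mul (hZb n hn) hl, ev_const_mul (hZ2 n hn) hL0] at h4
    have h5 := mul_le_mul_of_nonneg_left (hμ n hn) hl
    have h6 := mul_le_mul_of_nonneg_left (hσ n hn) hL0
    have h7 : 1 + S.ev (fun ω => l * Z n (X n ω) + l ^ 2 * L * Z n (X n ω) ^ 2)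
        ≤ Real.exp (κ n) := by
      have := Real.add_one_le_exp (κ n)
      simp only [hκ] at this ⊢
      linarith
    calc _ ≤ Real.exp (-κ n) * Real.exp (κ n) :=
          mul_le_mul_of_nonneg_left h7 (Real.exp_pos _).le
      _ = 1 := by rw [← Real.exp_add]; simp

/-- For independent variables, a lower bound for the capacity of a union. -/
theorem IndepSeq.one_sub_prod_le_ev {X : ℕ → Ω → ℝ} (hind : S.IndepSeq X)
    (hX : ∀ n, 1 ≤ n → X n ∈ S.H) {B : ℕ → Set ℝ} (hB : ∀ n, MeasurableSet (B n)) (m : ℕ) :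
    ∃ φ : (Fin m → ℝ) → ℝ, Measurable φ ∧ (∀ x, 0 ≤ φ x) ∧ (∀ x, φ x ≤ 1) ∧
      S.IsBdd (fun ω => φ (tuple X m ω)) ∧
      1 - ∏ i ∈ Finset.Icc 1 m, (1 - S.ev ((X i ⁻¹' B i).indicator fun _ => 1)) ≤
        S.ev (fun ω => φ (tuple X m ω)) ∧
      ∀ ω, φ (tuple X m ω) ≤ (⋃ i ∈ Finset.Icc 1 m, X i ⁻¹' B i).indicator (fun _ => 1) ω := by
  induction m with
  | zero =>
    refine ⟨fun _ => 0, measurable_const, fun _ => le_rfl, fun _ => zero_le_one, isBdd_const 0,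
      ?_, ?_⟩
    · simp [ev_const]
    · simp
  | succ m ih =>
    obtain ⟨φ, hφ, hφ0, hφ1, hφb, hφe, hφs⟩ := ih
    have hm1 : 1 ≤ m + 1 := Nat.succ_pos m
    have hm := S.measurable_of_mem _ (hX _ hm1) (hB (m + 1))
    have hIb := isBdd_indicator (S := S) hm
    set v := S.ev ((X (m + 1) ⁻¹' B (m + 1)).indicator fun _ => 1) with hv
    have hv0 : 0 ≤ v := ev_nonneg hIb fun ω => Set.indicator_nonneg (fun _ _ => zero_le_one) ω
    have hv1 : v ≤ 1 := by
      rw [← ev_const (S := S) 1]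
      exact ev_mono hIb (isBdd_const 1) fun ω =>
        Set.indicator_le_self' (fun _ _ => zero_le_one) ω
    set I : ℝ → ℝ := (B (m + 1)).indicator fun _ => 1 with hI
    have hI0 : ∀ y, 0 ≤ I y := fun y => Set.indicator_nonneg (fun _ _ => zero_le_one) y
    have hI1 : ∀ y, I y ≤ 1 := fun y => Set.indicator_le_self' (fun _ _ => zero_le_one) y
    have hIm : Measurable I := measurable_const.indicator (hB _)
    have hcb : S.IsBdd (fun ω => 1 - φ (tuple X m ω)) := by
      simpa [sub_eq_add_neg] using (isBdd_const 1).add ((isBdd_const (-1)).mul hφb)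
    -- The recursion for the indicator of a union. Replacing the new indicator by v gives φ + (1-φ)v
    -- = v + (1-v)φ with 1 - v ≥ 0, so positive homogeneity suffices to evaluate the expectation.
    refine ⟨fun x => φ (dropLast x) + (1 - φ (dropLast x)) * I (x (Fin.last m)), ?_, ?_, ?_, ?_,
      ?_, ?_⟩
    · have hi := measurable_dropLast m
      exact (hφ.comp hi).add ((measurable_const.sub (hφ.comp hi)).mul
        (hIm.comp (measurable_pi_apply _)))
    · exact fun x => add_nonneg (hφ0 _) (mul_nonneg (sub_nonneg.2 (hφ1 _)) (hI0 _))
    · intro x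
      have h1 := hφ1 (dropLast x)
      have h2 := hI1 (x (Fin.last m))
      nlinarith
    · exact hφb.add (hcb.mul hIb)
    · have key := hind.ev_add_mul m (g := φ) (h := fun x => 1 - φ x) hφ
        (measurable_const.sub hφ) hIm hφb hcb hIb hφ0 (fun x => sub_nonneg.2 (hφ1 x)) hI0
      have h1 : S.ev (fun ω => φ (tuple X m ω) + (1 - φ (tuple X m ω)) * v) =
          v + (1 - v) * S.ev (fun ω => φ (tuple X m ω)) := by
        rw [← ev_const_mul hφb (sub_nonneg.2 hv1), ← ev_const_add ((isBdd_const _).mul hφb)]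
        congr 1
        funext ω
        ring
      refine le_trans ?_ key.ge
      change _ ≤ S.ev (fun ω => φ (tuple X m ω) + (1 - φ (tuple X m ω)) * v)
      rw [h1, Finset.prod_Icc_succ_top hm1, ← hv]
      nlinarith
    · intro ω
      change φ (tuple X m ω) + (1 - φ (tuple X m ω)) * I (X (m + 1) ω) ≤ _
      by_cases h : X (m + 1) ω ∈ B (m + 1)
      · rw [Set.indicator_of_mem]
        · simp [hI, h]
        · simp only [Set.mem_iUnion]
          exact ⟨m + 1, by simp, h⟩
      · refine le_trans ?_ ((hφs ω).trans
          (Set.indicator_le_indicator_of_subset ?_ (fun _ => zero_le_one) ω))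
        · simp [hI, h]
        · exact Set.biUnion_subset_biUnion_left (Finset.Icc_subset_Icc_right (Nat.le_succ m))

/-- The product bound in exponential form, from 1 - v ≤ e^{-v}; it plays the role of the second
Borel–Cantelli lemma. -/
theorem IndepSeq.one_sub_exp_le_capacity_iUnion {X : ℕ → Ω → ℝ} (hind : S.IndepSeq X)
    (hX : ∀ n, 1 ≤ n → X n ∈ S.H) {B : ℕ → Set ℝ} (hB : ∀ n, MeasurableSet (B n)) (m : ℕ) :
    ENNReal.ofReal (1 - Real.exp (-∑ i ∈ Finset.Icc 1 m, (S.capacity (X i ⁻¹' B i)).toReal)) ≤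
      S.capacity (⋃ i ∈ Finset.Icc 1 m, X i ⁻¹' B i) := by
  obtain ⟨φ, hφ, hφ0, hφ1, hφb, hφe, hφs⟩ := hind.one_sub_prod_le_ev hX hB m
  have hBm : ∀ i ∈ Finset.Icc 1 m, MeasurableSet (X i ⁻¹' B i) := fun i hi =>
    S.measurable_of_mem _ (hX _ (Finset.mem_Icc.1 hi).1) (hB i)
  have hU := Finset.measurableSet_biUnion _ hBm
  rw [capacity_eq hU]
  refine ENNReal.ofReal_le_ofReal (le_trans ?_ (hφe.trans (ev_mono hφb (isBdd_indicator hU) hφs)))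
  rw [← Finset.sum_neg_distrib, Real.exp_sum, sub_le_sub_iff_left]
  refine Finset.prod_le_prod (fun i hi => ?_) (fun i hi => ?_)
  · rw [sub_nonneg]
    exact (ev_mono (isBdd_indicator (hBm i hi)) (isBdd_const 1) fun ω =>
        Set.indicator_le_self' (fun _ _ => zero_le_one) ω).trans (ev_const 1).le
  · rw [capacity_eq (hBm i hi), ENNReal.toReal_ofReal (ev_nonneg (isBdd_indicator (hBm i hi))
      fun ω => Set.indicator_nonneg (fun _ _ => zero_le_one) ω)]
    linarith [Real.add_one_le_exp (-S.ev ((X i ⁻¹' B i).indicator fun _ => 1))]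

end SublinearExpectation
end

/-! ### Series of capacities, Choquet integrals and expectations. -/

noncomputable section

namespace SublinearExpectation
open MeasureTheory

/-- Layer cake in the value of the capacity instead of over Ω; this replaces Fubini, which needs
additivity. -/
theorem eq_lintegral_ite_lt {v : ℝ≥0∞} (hv : v ≤ 1) :
    v = ∫⁻ s in Set.Ioo (0 : ℝ) 1, if ENNReal.ofReal s < v then 1 else 0 := by
  have hv' : v ≠ ⊤ := (hv.trans_lt ENNReal.one_lt_top).ne
  have h1 : (fun s : ℝ => if ENNReal.ofReal s < v then (1 : ℝ≥0∞) else 0) =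
      {s : ℝ | ENNReal.ofReal s < v}.indicator 1 := by
    funext s; simp [Set.indicator_apply]
  have hm : MeasurableSet {s : ℝ | ENNReal.ofReal s < v} :=
    measurableSet_lt ENNReal.measurable_ofReal measurable_const
  rw [h1, lintegral_indicator_one hm, Measure.restrict_apply hm]
  have h2 : {s : ℝ | ENNReal.ofReal s < v} ∩ Set.Ioo 0 1 = Set.Ioo 0 v.toReal := by
    ext s
    simp only [Set.mem_inter_iff, Set.mem_ofPred_eq, Set.mem_Ioo]
    constructor
    · rintro ⟨h, h0, -⟩
      exact ⟨h0, (ENNReal.ofReal_lt_iff_lt_toReal h0.le hv').1 h⟩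
    · rintro ⟨h0, h⟩
      exact ⟨(ENNReal.ofReal_lt_iff_lt_toReal h0.le hv').2 h, h0,
        h.trans_le (ENNReal.toReal_le_of_le_ofReal zero_le_one (by simpa using hv))⟩
  rw [h2, Real.volume_Ioo, sub_zero, ENNReal.ofReal_toReal hv']

theorem measurable_ite_lt (v w : ℝ≥0∞) :
    Measurable fun s : ℝ => if ENNReal.ofReal s < v then w else 0 :=
  Measurable.ite (measurableSet_lt ENNReal.measurable_ofReal measurable_const)
    measurable_const measurable_const

theorem tsum_mul_eq_lintegral {ι : Type*} [Countable ι] (w F : ι → ℝ≥0∞) (hF : ∀ i, F i ≤ 1) :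
    ∑' i, w i * F i =
      ∫⁻ s in Set.Ioo (0 : ℝ) 1, ∑' i, if ENNReal.ofReal s < F i then w i else 0 := by
  rw [lintegral_tsum fun i => (measurable_ite_lt (F i) (w i)).aemeasurable]
  refine tsum_congr fun i => ?_
  conv_lhs => rw [eq_lintegral_ite_lt (hF i)]
  rw [← lintegral_const_mul _ (measurable_ite_lt _ _)]
  simp only [mul_ite, mul_one, mul_zero]

theorem lintegral_eq_lintegral_volume {G : ℝ → ℝ≥0∞} (hG : Antitone G) (hG1 : ∀ y, G y ≤ 1) :
    ∫⁻ y in Set.Ioi (0 : ℝ), G y =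
      ∫⁻ s in Set.Ioo (0 : ℝ) 1, volume ({y | ENNReal.ofReal s < G y} ∩ Set.Ioi 0) := by
  have h0 : ∀ y, G y = ∫⁻ s in Set.Ioo (0 : ℝ) 1, if ENNReal.ofReal s < G y then 1 else 0 :=
    fun y => eq_lintegral_ite_lt (hG1 y)
  have hGm := hG.measurable
  conv_lhs => enter [2, y]; rw [h0]
  rw [lintegral_lintegral_swap]
  · refine lintegral_congr fun s => ?_
    have hm : MeasurableSet {y : ℝ | ENNReal.ofReal s < G y} :=
      measurableSet_lt measurable_const hGm
    rw [← Measure.restrict_apply hm, ← lintegral_indicator_one hm]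
    refine lintegral_congr fun y => ?_
    simp [Set.indicator_apply]
  · refine Measurable.aemeasurable ?_
    exact Measurable.ite (measurableSet_lt (ENNReal.measurable_ofReal.comp measurable_snd)
      (hGm.comp measurable_fst)) measurable_const measurable_const

theorem lintegral_Ioo_mul_add_const {C C' : ℝ≥0∞} (hC : C ≠ ⊤) (f : ℝ → ℝ≥0∞) :
    ∫⁻ s in Set.Ioo (0 : ℝ) 1, (C * f s + C') = C * (∫⁻ s in Set.Ioo (0 : ℝ) 1, f s) + C' := by
  rw [lintegral_add_right _ measurable_const, lintegral_const_mul' _ _ hC]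
  simp

variable {Ω : Type*} [MeasurableSpace Ω] {S : SublinearExpectation Ω}

theorem antitone_capacity_lt (Y : Ω → ℝ) : Antitone fun y => S.capacity {ω | y < Y ω} :=
  fun _ _ h => capacity_mono fun _ hω => lt_of_le_of_lt h hω

/-- Sums `∑ wᵢ V(Y > xᵢ)` are dominated by `∫ V(h(Y) > y) dy` if the mass that the weights `wᵢ`
put on `[0, T]` is dominated by `h T`. -/
theorem tsum_capacity_le_lintegral {ι : Type*} [Countable ι] {w : ι → ℝ≥0∞} {x : ι → ℝ}
    (hx : ∀ i, 0 ≤ x i) {h : ℝ → ℝ} (hh : MonotoneOn h (Set.Ici 0)) {C C' : ℝ≥0∞} (hC : C ≠ ⊤)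
    (hN : ∀ T, 0 ≤ T → ∑' i, (if x i ≤ T then w i else 0) ≤ C * ENNReal.ofReal (h T) + C')
    (Y : Ω → ℝ) :
    ∑' i, w i * S.capacity {ω | x i < Y ω} ≤
      C * (∫⁻ y in Set.Ioi (0 : ℝ), S.capacity {ω | y < h (Y ω)}) + C' := by
  rw [tsum_mul_eq_lintegral _ _ fun i => S.capacity_le_one _,
    lintegral_eq_lintegral_volume (antitone_capacity_lt _) fun i => S.capacity_le_one _,
    ← lintegral_Ioo_mul_add_const hC]
  refine lintegral_mono fun s => ?_
  rw [ENNReal.tsum_eq_iSup_sum]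
  refine iSup_le fun t => ?_
  rw [← Finset.sum_filter]
  set t' := t.filter fun i => ENNReal.ofReal s < S.capacity {ω | x i < Y ω} with ht'
  rcases t'.eq_empty_or_nonempty with he | hne
  · rw [he]; simp
  -- Passing to a finite partial sum provides a largest threshold; all indices that are active at
  -- level s lie below it, so the counting hypothesis at T = x k bounds their weight.
  obtain ⟨k, hk, hmax⟩ := t'.exists_max_image x hne
  have hks : ENNReal.ofReal s < S.capacity {ω | x k < Y ω} := (Finset.mem_filter.1 hk).2
  calc ∑ i ∈ t', w i ≤ ∑ i ∈ t', (if x i ≤ x k then w i else 0) :=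
        Finset.sum_le_sum fun i hi => by rw [if_pos (hmax i hi)]
    _ ≤ ∑' i, (if x i ≤ x k then w i else 0) := ENNReal.sum_le_tsum _
    _ ≤ C * ENNReal.ofReal (h (x k)) + C' := hN _ (hx k)
    _ ≤ _ := by
        gcongr
        calc ENNReal.ofReal (h (x k)) = volume (Set.Ioo 0 (h (x k))) := by
              rw [Real.volume_Ioo, sub_zero]
          _ ≤ _ := by
              refine measure_mono fun y hy => ⟨?_, hy.1⟩
              refine hks.trans_le (capacity_mono fun ω hω => ?_)
              exact hy.2.trans_le (hh (hx k) ((hx k).trans (le_of_lt hω)) (le_of_lt hω))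

/-- Converse of `tsum_capacity_le_lintegral`. -/
theorem lintegral_le_tsum_capacity {ι : Type*} [Countable ι] {w : ι → ℝ≥0∞} {x : ι → ℝ}
    {h : ℝ → ℝ} (hh : MonotoneOn h (Set.Ici 0)) (hcont : ContinuousOn h (Set.Ici 0))
    (h0 : h 0 = 0) (hlim : Filter.Tendsto h Filter.atTop Filter.atTop) {C C' : ℝ≥0∞} (hC : C ≠ ⊤)
    (hN : ∀ T, 0 ≤ T → ENNReal.ofReal (h T) ≤ C * ∑' i, (if x i ≤ T then w i else 0) + C')
    {Y : Ω → ℝ} (hY : ∀ ω, 0 ≤ Y ω) :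
    ∫⁻ y in Set.Ioi (0 : ℝ), S.capacity {ω | y < h (Y ω)} ≤
      C * ∑' i, w i * S.capacity {ω | x i < Y ω} + C' := by
  rw [tsum_mul_eq_lintegral _ _ fun i => S.capacity_le_one _,
    lintegral_eq_lintegral_volume (antitone_capacity_lt _) fun i => S.capacity_le_one _,
    ← lintegral_Ioo_mul_add_const hC]
  refine lintegral_mono fun s => ?_
  set M := C * ∑' i, (if ENNReal.ofReal s < S.capacity {ω | x i < Y ω} then w i else 0) + C' with hM
  rcases eq_or_ne M ⊤ with hT | hT
  · exact hT ▸ le_top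
  have hsub : {y | ENNReal.ofReal s < S.capacity {ω | y < h (Y ω)}} ∩ Set.Ioi 0 ⊆
      Set.Ioc 0 M.toReal := by
    rintro y ⟨hy, hy0⟩
    refine ⟨hy0, ?_⟩
    -- Write y = h T by the intermediate value theorem. Every i with x i ≤ T is then active at level
    -- s, because h(Y) > h T forces Y > T ≥ x i.
    obtain ⟨b, hb0, hb⟩ := ((Filter.eventually_ge_atTop (0 : ℝ)).and
      (hlim.eventually_ge_atTop y)).exists
    obtain ⟨T, hT', hTy⟩ := intermediate_value_Icc hb0 (hcont.mono Set.Icc_subset_Ici_self)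
      (show y ∈ Set.Icc (h 0) (h b) from ⟨by rw [h0]; exact hy0.le, hb⟩)
    rw [← ENNReal.ofReal_le_iff_le_toReal hT, ← hTy]
    refine (hN T hT'.1).trans ?_
    rw [hM]
    gcongr with i
    split_ifs with h1 h2 h2
    · exact le_rfl
    · refine absurd (hy.trans_le (capacity_mono fun ω hω => ?_)) h2
      by_contra hc
      have hc' : Y ω ≤ T := (not_lt.1 hc).trans h1
      have h3 : y < h (Y ω) := hω
      rw [← hTy] at h3
      exact absurd h3 (not_lt.2 (hh (hY ω) hT'.1 hc'))
    · exact bot_le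
    · exact le_rfl
  calc _ ≤ volume (Set.Ioc 0 M.toReal) := measure_mono hsub
    _ = M := by rw [Real.volume_Ioc, sub_zero, ENNReal.ofReal_toReal hT]

/-- Countable sub-additivity enters here: ξ is at most the number of integers k ≥ 0 with k < ξ, so
E[ξ] is bounded by Σ V(ξ > k), which exceeds the integral by at most 1. -/
theorem CountablySubadditive.E_le_one_add_lintegral (hS : S.CountablySubadditive) {ξ : Ω → ℝ}
    (hξ : ξ ∈ S.H) (h0 : ∀ ω, 0 ≤ ξ ω) :
    (S.E ξ).toENNReal ≤ 1 + ((∫⁻ y in Set.Ioi (0 : ℝ), S.capacity {ω | y < ξ ω}) + 1) := by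
  have hm : ∀ k : ℕ, MeasurableSet {ω | ((k : ℝ)) < ξ ω} := fun k =>
    measurableSet_lt measurable_const (S.measurable_of_mem _ hξ)
  set Z : ℕ → Ω → ℝ := fun n => match n with
    | 0 => fun _ => 1
    | k + 1 => {ω | (k : ℝ) < ξ ω}.indicator fun _ => 1 with hZ
  have hZ0 : ∀ n ω, 0 ≤ Z n ω := by
    rintro (_ | k) ω
    · exact zero_le_one
    · exact Set.indicator_nonneg (fun _ _ => zero_le_one) ω
  have key := hS ξ Z hξ ?_ h0 hZ0 ?_
  · refine key.trans ?_
    rw [tsum_eq_zero_add' ENNReal.summable]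
    have e1 : (S.E (Z 0)).toENNReal = 1 := by
      change (S.E fun _ => 1).toENNReal = 1
      rw [S.const, EReal.toENNReal_of_ne_top (EReal.coe_ne_top _), EReal.toReal_coe,
        ENNReal.ofReal_one]
    have e2 : ∀ k : ℕ, (S.E (Z (k + 1))).toENNReal = 1 * S.capacity {ω | (k : ℝ) < ξ ω} := by
      intro k
      rw [capacity_eq (hm k), one_mul]
      change (S.E ({ω | (k : ℝ) < ξ ω}.indicator fun _ => 1)).toENNReal = _
      rw [← (isBdd_indicator (hm k)).coe_ev, EReal.toENNReal_of_ne_top (EReal.coe_ne_top _),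
        EReal.toReal_coe]
    rw [e1, tsum_congr e2]
    gcongr
    have := tsum_capacity_le_lintegral (S := S) (ι := ℕ) (w := fun _ => 1) (x := fun k => (k : ℝ))
      (fun k => Nat.cast_nonneg k) (h := id) (fun _ _ _ _ h => h) (C := 1) (C' := 1)
      ENNReal.one_ne_top (fun T hT => ?_) ξ
    · simpa using this
    · rw [tsum_eq_sum (s := Finset.range (⌊T⌋₊ + 1)), ← Finset.sum_filter]
      · rw [Finset.sum_const, nsmul_eq_mul, mul_one, one_mul, id]
        calc _ ≤ ((⌊T⌋₊ + 1 : ℕ) : ℝ≥0∞) := by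
              gcongr
              exact (Finset.card_filter_le _ _).trans (Finset.card_range _).le
          _ ≤ _ := by
              push_cast
              gcongr
              rw [← ENNReal.ofReal_natCast]
              exact ENNReal.ofReal_le_ofReal (Nat.floor_le hT)
      · intro k hk
        rw [if_neg]
        intro hkT
        exact hk (Finset.mem_range.2 (Nat.lt_succ_of_le (Nat.le_floor hkT)))
  · rintro (_ | k)
    · exact S.const_mem 1
    · exact S.indicator_mem _ (hm k)
  · intro ω
    set K := ⌈ξ ω⌉₊ with hK
    calc ENNReal.ofReal (ξ ω) ≤ ENNReal.ofReal (K : ℝ) :=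
          ENNReal.ofReal_le_ofReal (Nat.le_ceil _)
      _ = ∑ k ∈ Finset.range K, ENNReal.ofReal (Z (k + 1) ω) := by
          rw [Finset.sum_congr rfl (g := fun _ => (1 : ℝ≥0∞))]
          · simp
          · intro k hk
            have : (k : ℝ) < ξ ω := Nat.lt_ceil.1 (Finset.mem_range.1 hk)
            simp [hZ, this]
      _ ≤ ∑' k, ENNReal.ofReal (Z (k + 1) ω) := ENNReal.sum_le_tsum _
      _ ≤ ∑' k, ENNReal.ofReal (Z k ω) :=
          ENNReal.tsum_comp_le_tsum_of_injective (add_left_injective 1) _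

/-- If `∫ V(Y > y) dy < ∞` then the admissible variables between `0` and `K (1 + Y)` have
expectations bounded by a multiple of `K`. -/
theorem CountablySubadditive.exists_E_le (hS : S.CountablySubadditive) {Y : Ω → ℝ}
    (hfin : ∫⁻ y in Set.Ioi (0 : ℝ), S.capacity {ω | y < Y ω} < ⊤) :
    ∃ D : ℝ, 0 ≤ D ∧ ∀ ξ ∈ S.H, (∀ ω, 0 ≤ ξ ω) → ∀ K : ℝ, 0 < K → (∀ ω, ξ ω ≤ K * (1 + Y ω)) →
      S.E ξ ≤ ((K * D : ℝ) : EReal) := by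
  set I := ∫⁻ y in Set.Ioi (0 : ℝ), S.capacity {ω | y < Y ω} with hI
  refine ⟨(3 + I).toReal, ENNReal.toReal_nonneg, fun ξ hξ h0 K hK hle => ?_⟩
  -- `Y` need not be admissible, so only its events are used: η is admissible, {η > y} is contained
  -- in {Y > y} for y > 0, and ξ ≤ K(1 + η).
  set η : Ω → ℝ := fun ω => max (K⁻¹ * ξ ω - 1) 0 with hη
  have hmem : η ∈ S.H := by
    have h1 : (fun ω => K⁻¹ * ξ ω + (-1)) ∈ S.H :=
      S.add_mem (S.const_mul_mem _ hξ) (S.const_mem (-1))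
    exact S.lipschitz_comp_mem (f := fun x => max x 0)
      (LipschitzWith.of_le_add fun x y => by
        rcases max_cases x 0 with ⟨h, -⟩ | ⟨h, -⟩ <;> rw [h]
        · have := le_max_left y 0
          have := le_abs_self (x - y)
          rw [Real.dist_eq]; linarith
        · have := le_max_right y 0
          positivity) h1
  have hη0 : ∀ ω, 0 ≤ η ω := fun ω => le_max_right _ _
  have h1 := hS.E_le_one_add_lintegral hmem hη0
  have h2 : ∫⁻ y in Set.Ioi (0 : ℝ), S.capacity {ω | y < η ω} ≤ I := by
    refine setLIntegral_mono' measurableSet_Ioi fun y hy => capacity_mono fun ω hω => ?_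
    have hω' : y < max (K⁻¹ * ξ ω - 1) 0 := hω
    have h3 : y < K⁻¹ * ξ ω - 1 := by
      rcases lt_max_iff.1 hω' with h | h
      · exact h
      · exact absurd h (not_lt.2 (le_of_lt hy))
    have h4 : K⁻¹ * ξ ω ≤ 1 + Y ω := by
      rw [inv_mul_le_iff₀ hK]; exact hle ω
    change y < Y ω
    linarith
  have h3 : (S.E η).toENNReal ≤ 2 + I := by
    refine h1.trans ?_
    calc _ ≤ 1 + (I + 1) := by gcongr
      _ = 2 + I := by ring
  have h4 : S.E η ≤ (((2 + I).toReal : ℝ) : EReal) := by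
    calc S.E η ≤ ((S.E η).toENNReal : EReal) := (EReal.coe_toENNReal_eq_max).ge.trans' (le_max_right _ _)
      _ ≤ ((2 + I : ℝ≥0∞) : EReal) := by exact_mod_cast h3
      _ = _ := by
        rw [EReal.coe_ennreal_toReal]
        exact ENNReal.add_ne_top.2 ⟨by simp, hfin.ne⟩
  have h5 : S.E ξ ≤ S.E (fun ω => K * (1 + η ω)) := by
    refine S.mono _ (S.const_mul_mem K (S.add_mem (S.const_mem 1) hmem)) _ hξ fun ω => ?_
    have : K⁻¹ * ξ ω - 1 ≤ η ω := le_max_left _ _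
    calc ξ ω = K * (K⁻¹ * ξ ω) := by field_simp
      _ ≤ _ := by gcongr; linarith
  have h6 : S.E (fun ω => 1 + η ω) ≤ ((1 + (2 + I).toReal : ℝ) : EReal) := by
    refine (S.subadd _ (S.const_mem 1) _ hmem ?_ ?_).trans ?_
    · exact fun h => EReal.coe_ne_top 1 ((S.const 1).symm.trans h.1)
    · exact fun h => EReal.coe_ne_bot 1 ((S.const 1).symm.trans h.1)
    · rw [S.const, EReal.coe_add]; gcongr
  have h7 : 1 + (2 + I).toReal = (3 + I).toReal := by
    rw [ENNReal.toReal_add (by simp) hfin.ne, ENNReal.toReal_add (by simp) hfin.ne]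
    simp; ring
  refine h5.trans ?_
  rw [S.pos_homog _ (S.add_mem (S.const_mem 1) hmem) K hK.le, EReal.coe_mul, ← h7]
  exact mul_le_mul_of_nonneg_left h6 (by exact_mod_cast hK.le)

theorem choquet_lt_top_iff {Y : Ω → ℝ} (hY : ∀ ω, 0 ≤ Y ω) :
    S.choquet Y < ⊤ ↔ ∫⁻ y in Set.Ioi (0 : ℝ), S.capacity {ω | y < Y ω} < ⊤ := by
  have h : ∫⁻ x in Set.Iio (0 : ℝ), (1 - S.capacity {ω | x < Y ω}) = 0 := by
    rw [setLIntegral_congr_fun (g := fun _ => 0) measurableSet_Iio]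
    · simp
    · intro x hx
      have : {ω | x < Y ω} = Set.univ := Set.eq_univ_of_forall fun ω => lt_of_lt_of_le hx (hY ω)
      simp only [this, capacity_univ, tsub_self]
  rw [choquet, h]
  simp [lt_top_iff_ne_top]

end SublinearExpectation
end

/-! ### Power sums and the weight of pairs below a threshold. -/

noncomputable section

open Finset

theorem exists_sum_rpow_sub_one_le {γ : ℝ} (hγ : 0 < γ) :
    ∃ C : ℝ, 0 < C ∧ ∀ R : ℝ, 0 ≤ R → ∑ n ∈ Icc 1 ⌊R⌋₊, (n : ℝ) ^ (γ - 1) ≤ C * R ^ γ := by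
  suffices h : ∃ C : ℝ, 0 < C ∧ ∀ M : ℕ, ∑ n ∈ Icc 1 M, (n : ℝ) ^ (γ - 1) ≤ C * (M : ℝ) ^ γ by
    obtain ⟨C, hC, h⟩ := h
    refine ⟨C, hC, fun R hR => (h _).trans ?_⟩
    gcongr
    exact Nat.floor_le hR
  rcases le_total 1 γ with h1 | h1
  · refine ⟨1, one_pos, fun M => ?_⟩
    rcases Nat.eq_zero_or_pos M with rfl | hM
    · simp [Real.zero_rpow hγ.ne']
    calc ∑ n ∈ Icc 1 M, (n : ℝ) ^ (γ - 1) ≤ ∑ n ∈ Icc 1 M, (M : ℝ) ^ (γ - 1) := by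
          refine sum_le_sum fun n hn => ?_
          have := (mem_Icc.1 hn).2
          exact Real.rpow_le_rpow (Nat.cast_nonneg _) (by exact_mod_cast this) (by linarith)
      _ = 1 * (M : ℝ) ^ γ := by
          have hM' : (0 : ℝ) < M := by exact_mod_cast hM
          rw [sum_const, Nat.card_Icc, nsmul_eq_mul, Real.rpow_sub_one hM'.ne']
          simp
          field_simp
  -- For γ ≤ 1, Bernoulli's inequality (1 - 1/x)^γ ≤ 1 - γ/x shows that x^γ/γ increases by at least
  -- x^{γ-1} from x - 1 to x.
  · refine ⟨1 / γ, by positivity, fun M => ?_⟩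
    induction M with
    | zero => simp [Real.zero_rpow hγ.ne']
    | succ M ih =>
      rw [sum_Icc_succ_top (Nat.succ_pos M)]
      have hx : (0 : ℝ) < ((M + 1 : ℕ) : ℝ) := by positivity
      set x : ℝ := ((M + 1 : ℕ) : ℝ) with hxdef
      have hMx : (M : ℝ) = (1 + -x⁻¹) * x := by
        rw [hxdef]; push_cast; field_simp; ring
      have hx1 : 1 ≤ x := by rw [hxdef]; push_cast; linarith [Nat.cast_nonneg (α := ℝ) M]
      have hinv : x⁻¹ ≤ 1 := inv_le_one_of_one_le₀ hx1
      have hb := rpow_one_add_le_one_add_mul_self (s := -x⁻¹) (by linarith) hγ.le h1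
      have h2 : (M : ℝ) ^ γ ≤ (1 + γ * -x⁻¹) * x ^ γ := by
        rw [hMx, Real.mul_rpow (by linarith) hx.le]
        gcongr
      have h3 : x ^ (γ - 1) = x⁻¹ * x ^ γ := by
        rw [Real.rpow_sub_one hx.ne']; field_simp
      have h4 : 1 / γ * (M : ℝ) ^ γ ≤ 1 / γ * ((1 + γ * -x⁻¹) * x ^ γ) := by gcongr
      have h5 : 1 / γ * ((1 + γ * -x⁻¹) * x ^ γ) = 1 / γ * x ^ γ - x⁻¹ * x ^ γ := by
        field_simp; ring
      rw [h3]
      linarith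

/-- On (R/2, R] each term is at least min(1, 2^{-e}) R^e, whatever the sign of e, and for R ≥ 4
there are at least R/4 integers in this block. -/
theorem exists_le_sum_Ioc_rpow (e : ℝ) :
    ∃ c : ℝ, 0 < c ∧ ∀ R : ℝ, 4 ≤ R →
      c * R ^ (e + 1) ≤ ∑ n ∈ Ioc ⌊R / 2⌋₊ ⌊R⌋₊, (n : ℝ) ^ e := by
  have h2e : (0 : ℝ) < (1 / 2) ^ e := by positivity
  refine ⟨min 1 ((1 / 2) ^ e) / 4, by positivity, fun R hR => ?_⟩
  have hR0 : 0 < R := by linarith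
  have hterm : ∀ n ∈ Ioc ⌊R / 2⌋₊ ⌊R⌋₊, min 1 ((1 / 2) ^ e) * R ^ e ≤ (n : ℝ) ^ e := by
    intro n hn
    obtain ⟨h1, h2⟩ := mem_Ioc.1 hn
    have h1' : R / 2 < n := (Nat.floor_lt (by positivity)).1 h1
    have h2' : (n : ℝ) ≤ R := (Nat.le_floor_iff hR0.le).1 h2
    have hn0 : (0 : ℝ) < n := by linarith
    rcases le_total 0 e with he | he
    · calc _ ≤ (1 / 2) ^ e * R ^ e := by gcongr; exact min_le_right _ _
        _ = (R / 2) ^ e := by rw [← Real.mul_rpow (by norm_num) hR0.le]; ring_nf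
        _ ≤ _ := Real.rpow_le_rpow (by positivity) h1'.le he
    · calc _ ≤ 1 * R ^ e := by gcongr; exact min_le_left _ _
        _ = R ^ e := one_mul _
        _ ≤ _ := Real.rpow_le_rpow_of_nonpos hn0 h2' he
  have hcard : R / 4 ≤ ((Ioc ⌊R / 2⌋₊ ⌊R⌋₊).card : ℝ) := by
    rw [Nat.card_Ioc, Nat.cast_sub (Nat.floor_le_floor (by linarith))]
    have := Nat.lt_floor_add_one R
    have := Nat.floor_le (show 0 ≤ R / 2 by positivity)
    linarith
  calc _ = R / 4 * (min 1 ((1 / 2) ^ e) * R ^ e) := by rw [Real.rpow_add_one hR0.ne']; ring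
    _ ≤ ((Ioc ⌊R / 2⌋₊ ⌊R⌋₊).card : ℝ) * (min 1 ((1 / 2) ^ e) * R ^ e) := by gcongr
    _ = ∑ n ∈ Ioc ⌊R / 2⌋₊ ⌊R⌋₊, min 1 ((1 / 2) ^ e) * R ^ e := by
        rw [sum_const, nsmul_eq_mul]
    _ ≤ _ := sum_le_sum hterm

/-- The threshold `δ n^α k^{-β}` attached to `z = (k, n)`. -/
def threshold (α β δ : ℝ) (z : ℕ × ℕ) : ℝ := δ * ((z.2 : ℝ) ^ α * (z.1 : ℝ) ^ (-β))

/-- The weight `n^{r-2}` of the pair `(k, n)`, `1 ≤ k < n`. -/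
def pairWeight (r : ℝ) (z : ℕ × ℕ) : ℝ≥0∞ :=
  if 1 ≤ z.1 ∧ z.1 < z.2 then ENNReal.ofReal ((z.2 : ℝ) ^ (r - 2)) else 0

/-- The total weight of the pairs whose threshold is at most `T`. -/
def thresholdCount (r α β δ T : ℝ) : ℝ≥0∞ :=
  ∑' z : ℕ × ℕ, if threshold α β δ z ≤ T then pairWeight r z else 0

theorem rpow_le_mul_rpow_of_threshold_le {α β δ T : ℝ} (hδ : 0 < δ) {k n : ℕ} (hk : 1 ≤ k)
    (h : threshold α β δ (k, n) ≤ T) : (n : ℝ) ^ α ≤ T / δ * (k : ℝ) ^ β := by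
  have hk' : (0 : ℝ) < k := by exact_mod_cast hk
  have hkβ : (0 : ℝ) < (k : ℝ) ^ β := Real.rpow_pos_of_pos hk' _
  rw [threshold, Real.rpow_neg hk'.le] at h
  rw [div_mul_eq_mul_div, le_div_iff₀ hδ]
  have h2 := mul_le_mul_of_nonneg_right h hkβ.le
  have h3 : δ * ((n : ℝ) ^ α * ((k : ℝ) ^ β)⁻¹) * (k : ℝ) ^ β = (n : ℝ) ^ α * δ := by
    field_simp
  simp only at h2
  linarith

/-- With U = T/δ, the constraint for fixed k is n ≤ (U k^β)^{1/α}, and the weights up to there sum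
to order (U k^β)^{(r-1)/α}. From k < n follows k^α ≤ U k^β, that is k ≤ U^{1/p}, so no other k
contributes. -/
theorem exists_thresholdCount_le {r p β : ℝ} (hr : 1 < r) (hp : 0 < p) (hα : 0 < p + β) :
    ∃ C : ℝ, 0 < C ∧ ∀ δ T : ℝ, 0 < δ → 0 ≤ T →
      thresholdCount r (p + β) β δ T ≤ ENNReal.ofReal
        (C * ((T / δ) ^ ((r - 1) / (p + β)) *
          ∑ k ∈ Icc 1 ⌊(T / δ) ^ (1 / p)⌋₊, (k : ℝ) ^ (β * ((r - 1) / (p + β))))) := by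
  obtain ⟨C, hC, hsum⟩ := exists_sum_rpow_sub_one_le (γ := r - 1) (by linarith)
  refine ⟨C, hC, fun δ T hδ hT => ?_⟩
  set α := p + β with hαdef
  set U := T / δ with hU
  have hU0 : 0 ≤ U := by positivity
  rw [thresholdCount, ENNReal.tsum_prod (f := fun k n =>
    if threshold α β δ (k, n) ≤ T then pairWeight r (k, n) else 0)]
  have hk : ∀ k : ℕ, (∑' n : ℕ, if threshold α β δ (k, n) ≤ T then pairWeight r (k, n) else 0) ≤
      if k ∈ Icc 1 ⌊U ^ (1 / p)⌋₊ then
        ENNReal.ofReal (C * (U ^ ((r - 1) / α) * (k : ℝ) ^ (β * ((r - 1) / α)))) else 0 := by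
    intro k
    by_cases hkm : k ∈ Icc 1 ⌊U ^ (1 / p)⌋₊
    · rw [if_pos hkm]
      have hk1 : 1 ≤ k := (mem_Icc.1 hkm).1
      have hk' : (0 : ℝ) < k := by exact_mod_cast hk1
      set R := (U * (k : ℝ) ^ β) ^ (1 / α) with hR
      have hUk : 0 ≤ U * (k : ℝ) ^ β := by positivity
      have hR0 : 0 ≤ R := by positivity
      calc _ ≤ ∑' n : ℕ, (if n ∈ Icc 1 ⌊R⌋₊ then
              ENNReal.ofReal ((n : ℝ) ^ (r - 1 - 1)) else 0) := by
            refine ENNReal.tsum_le_tsum fun n => ?_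
            by_cases h1 : threshold α β δ (k, n) ≤ T
            · rw [if_pos h1, pairWeight]
              by_cases h2 : 1 ≤ k ∧ k < n
              · rw [if_pos h2, if_pos]
                · simp only; ring_nf; exact le_rfl
                · rw [mem_Icc]
                  refine ⟨by omega, Nat.le_floor ?_⟩
                  have := rpow_le_mul_rpow_of_threshold_le hδ h2.1 h1
                  calc (n : ℝ) = ((n : ℝ) ^ α) ^ (1 / α) := by
                        rw [← Real.rpow_mul (Nat.cast_nonneg _), mul_one_div_cancel hα.ne',
                          Real.rpow_one]
                    _ ≤ _ := Real.rpow_le_rpow (by positivity) this (by positivity)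
              · rw [if_neg h2]; exact bot_le
            · rw [if_neg h1]; exact bot_le
        _ = ENNReal.ofReal (∑ n ∈ Icc 1 ⌊R⌋₊, (n : ℝ) ^ (r - 1 - 1)) := by
            rw [tsum_eq_sum (s := Icc 1 ⌊R⌋₊) fun n hn => if_neg hn,
              ENNReal.ofReal_sum_of_nonneg fun n _ => by positivity]
            exact sum_congr rfl fun n hn => if_pos hn
        _ ≤ _ := by
            refine ENNReal.ofReal_le_ofReal ((hsum R hR0).trans (le_of_eq ?_))
            rw [hR, ← Real.rpow_mul hUk, Real.mul_rpow hU0 (by positivity),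
              ← Real.rpow_mul hk'.le]
            ring_nf
    · rw [if_neg hkm]
      refine le_of_eq (ENNReal.tsum_eq_zero.2 fun n => ?_)
      by_cases h1 : threshold α β δ (k, n) ≤ T
      · rw [if_pos h1, pairWeight, if_neg]
        rintro ⟨h2, h3⟩
        refine hkm (mem_Icc.2 ⟨h2, Nat.le_floor ?_⟩)
        have h4 := rpow_le_mul_rpow_of_threshold_le hδ h2 h1
        have hk' : (0 : ℝ) < k := by exact_mod_cast h2
        have h5 : (k : ℝ) ^ α ≤ (n : ℝ) ^ α :=
          Real.rpow_le_rpow hk'.le (by exact_mod_cast h3.le) hα.le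
        have h6 : (k : ℝ) ^ p ≤ U := by
          have h7 := h5.trans h4
          rw [hαdef, Real.rpow_add hk'] at h7
          exact le_of_mul_le_mul_right h7 (Real.rpow_pos_of_pos hk' _)
        calc (k : ℝ) = ((k : ℝ) ^ p) ^ (1 / p) := by
              rw [← Real.rpow_mul hk'.le, mul_one_div_cancel hp.ne', Real.rpow_one]
          _ ≤ _ := Real.rpow_le_rpow (by positivity) h6 (by positivity)
      · rw [if_neg h1]
  refine (ENNReal.tsum_le_tsum hk).trans (le_of_eq ?_)
  rw [tsum_eq_sum (s := Icc 1 ⌊U ^ (1 / p)⌋₊) fun n hn => if_neg hn, mul_sum, mul_sum,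
    ENNReal.ofReal_sum_of_nonneg fun n _ => by positivity]
  exact sum_congr rfl fun n hn => if_pos hn

/-- The factor 4^{α/p} ensures 4^α k^p ≤ T, hence R = (T k^β)^{1/α} ≥ 4k. The block (R/2, R] then
lies above k and is long enough for `exists_le_sum_Ioc_rpow`. -/
theorem exists_le_thresholdCount {r p β : ℝ} (hp : 0 < p) (hα : 0 < p + β) :
    ∃ c : ℝ, 0 < c ∧ ∀ T : ℝ, 0 ≤ T →
      ENNReal.ofReal (c * (T ^ ((r - 1) / (p + β)) *
        ∑ k ∈ Icc 1 ⌊T ^ (1 / p) / 4 ^ ((p + β) / p)⌋₊, (k : ℝ) ^ (β * ((r - 1) / (p + β))))) ≤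
      thresholdCount r (p + β) β 1 T := by
  obtain ⟨c, hc, hsum⟩ := exists_le_sum_Ioc_rpow (r - 2)
  refine ⟨c, hc, fun T hT => ?_⟩
  set α := p + β with hαdef
  set K := ⌊T ^ (1 / p) / 4 ^ (α / p)⌋₊ with hK
  rw [thresholdCount, ENNReal.tsum_prod (f := fun k n =>
    if threshold α β 1 (k, n) ≤ T then pairWeight r (k, n) else 0), mul_sum, mul_sum,
    ENNReal.ofReal_sum_of_nonneg fun n _ => by positivity]
  refine le_trans (sum_le_sum fun k hk => ?_) (ENNReal.sum_le_tsum (Icc 1 K))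
  obtain ⟨hk1, hk2⟩ := mem_Icc.1 hk
  have hk' : (0 : ℝ) < k := by exact_mod_cast hk1
  have hk1' : (1 : ℝ) ≤ k := by exact_mod_cast hk1
  have h1 : (k : ℝ) ≤ T ^ (1 / p) / 4 ^ (α / p) := (Nat.le_floor_iff (by positivity)).1 hk2
  have h2 : (4 : ℝ) ^ α * (k : ℝ) ^ p ≤ T := by
    rw [le_div_iff₀ (by positivity)] at h1
    have := Real.rpow_le_rpow (by positivity) h1 hp.le
    rw [Real.mul_rpow hk'.le (by positivity), ← Real.rpow_mul (by norm_num), ← Real.rpow_mul hT,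
      div_mul_cancel₀ _ hp.ne', div_mul_cancel₀ _ hp.ne', Real.rpow_one] at this
    linarith
  have hUk : 0 ≤ T * (k : ℝ) ^ β := by positivity
  set R := (T * (k : ℝ) ^ β) ^ (1 / α) with hR
  have hRα : R ^ α = T * (k : ℝ) ^ β := by
    rw [hR, ← Real.rpow_mul hUk, one_div_mul_cancel hα.ne', Real.rpow_one]
  have hR0 : 0 ≤ R := by positivity
  have h4k : 4 * (k : ℝ) ≤ R := by
    rw [← Real.rpow_le_rpow_iff (by positivity) hR0 hα, hRα, Real.mul_rpow (by norm_num) hk'.le,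
      hαdef, Real.rpow_add hk' p β, ← hαdef, ← mul_assoc]
    gcongr
  calc _ = ENNReal.ofReal (c * R ^ (r - 2 + 1)) := by
        congr 2
        rw [hR, ← Real.rpow_mul hUk, Real.mul_rpow hT (by positivity), ← Real.rpow_mul hk'.le]
        ring_nf
    _ ≤ ENNReal.ofReal (∑ n ∈ Ioc ⌊R / 2⌋₊ ⌊R⌋₊, (n : ℝ) ^ (r - 2)) :=
        ENNReal.ofReal_le_ofReal (hsum R (by linarith))
    _ = ∑ n ∈ Ioc ⌊R / 2⌋₊ ⌊R⌋₊,
          (if threshold α β 1 (k, n) ≤ T then pairWeight r (k, n) else 0) := by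
        rw [ENNReal.ofReal_sum_of_nonneg fun n _ => by positivity]
        refine sum_congr rfl fun n hn => ?_
        obtain ⟨h5, h6⟩ := mem_Ioc.1 hn
        have h5' : R / 2 < n := (Nat.floor_lt (by positivity)).1 h5
        have h6' : (n : ℝ) ≤ R := (Nat.le_floor_iff hR0).1 h6
        have h7 : k < n := by
          have : (k : ℝ) < n := by linarith
          exact_mod_cast this
        rw [if_pos, pairWeight, if_pos ⟨hk1, h7⟩]
        have h8 := Real.rpow_le_rpow (Nat.cast_nonneg n) h6' hα.le
        rw [hRα] at h8
        rw [threshold, one_mul, Real.rpow_neg hk'.le, ← div_eq_mul_inv,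
          div_le_iff₀ (Real.rpow_pos_of_pos hk' _)]
        exact h8
    _ ≤ _ := ENNReal.sum_le_tsum _
end

/-! ### The moment function and its comparison with the pair count. -/

noncomputable section

open Finset

/-- The function `h` such that the moment condition reads `C_V(h(|X|)) < ∞`. -/
def momentFun (r p β t : ℝ) : ℝ :=
  if β < -p / r then t ^ ((r - 1) / (p + β))
  else if β = -p / r then t ^ (r / p) * Real.log (1 + t)
  else t ^ (r / p)

section
variable {r p β : ℝ}

theorem momentFun_of_lt (h : β < -p / r) (t : ℝ) :
    momentFun r p β t = t ^ ((r - 1) / (p + β)) := if_pos h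

theorem momentFun_of_eq (h : β = -p / r) (t : ℝ) :
    momentFun r p β t = t ^ (r / p) * Real.log (1 + t) := by
  rw [momentFun, if_neg h.not_lt, if_pos h]

theorem momentFun_of_gt (h : -p / r < β) (t : ℝ) : momentFun r p β t = t ^ (r / p) := by
  rw [momentFun, if_neg h.not_gt, if_neg h.ne']

theorem momentFun_nonneg {t : ℝ} (ht : 0 ≤ t) : 0 ≤ momentFun r p β t := by
  have := Real.log_nonneg (show 1 ≤ 1 + t by linarith)
  unfold momentFun
  split_ifs <;> positivity

theorem momentFun_zero (hr : 1 < r) (hp : 0 < p) (hα : 0 < p + β) : momentFun r p β 0 = 0 := by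
  have h1 : (r - 1) / (p + β) ≠ 0 := (div_pos (by linarith) hα).ne'
  have h2 : r / p ≠ 0 := (div_pos (by linarith) hp).ne'
  unfold momentFun
  split_ifs <;> simp [h1, h2]

theorem momentFun_monotoneOn (hr : 1 < r) (hp : 0 < p) (hα : 0 < p + β) :
    MonotoneOn (momentFun r p β) (Set.Ici 0) := by
  intro s hs t ht hst
  have hs' : 0 ≤ s := hs
  have h1 : 0 ≤ (r - 1) / (p + β) := (div_pos (by linarith) hα).le
  have h2 : 0 ≤ r / p := (div_pos (by linarith) hp).le
  have h3 : 0 ≤ Real.log (1 + s) := Real.log_nonneg (by linarith)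
  unfold momentFun
  have ht' : 0 ≤ t := ht
  split_ifs <;> gcongr

theorem momentFun_continuousOn (hr : 1 < r) (hp : 0 < p) (hα : 0 < p + β) :
    ContinuousOn (momentFun r p β) (Set.Ici 0) := by
  have h1 : 0 ≤ (r - 1) / (p + β) := (div_pos (by linarith) hα).le
  have h2 : 0 ≤ r / p := (div_pos (by linarith) hp).le
  unfold momentFun
  split_ifs
  · exact (Real.continuous_rpow_const h1).continuousOn
  · refine (Real.continuous_rpow_const h2).continuousOn.mul (ContinuousOn.log (by fun_prop) ?_)
    intro x hx
    have hx' : 0 ≤ x := hx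
    positivity
  · exact (Real.continuous_rpow_const h2).continuousOn

theorem momentFun_tendsto (hr : 1 < r) (hp : 0 < p) (hα : 0 < p + β) :
    Filter.Tendsto (momentFun r p β) Filter.atTop Filter.atTop := by
  have h1 : 0 < (r - 1) / (p + β) := div_pos (by linarith) hα
  have h2 : 0 < r / p := div_pos (by linarith) hp
  unfold momentFun
  split_ifs
  · exact tendsto_rpow_atTop h1
  · exact (tendsto_rpow_atTop h2).atTop_mul_atTop₀
      (Real.tendsto_log_atTop.comp (Filter.tendsto_atTop_add_const_left _ _ Filter.tendsto_id))
  · exact tendsto_rpow_atTop h2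

theorem rpow_le_one_add_rpow {s t u : ℝ} (hs : 0 ≤ s) (hst : s ≤ t) (hu : 0 ≤ u) :
    u ^ s ≤ 1 + u ^ t := by
  rcases le_total u 1 with h | h
  · have := Real.rpow_le_one hu h hs
    have : 0 ≤ u ^ t := by positivity
    linarith
  · have := Real.rpow_le_rpow_of_exponent_le h hst
    linarith

theorem rpow_le_one_add_mul_log {s t : ℝ} (hs : 0 ≤ s) (ht : 0 ≤ t) :
    t ^ s ≤ 1 + 2 * (t ^ s * Real.log (1 + t)) := by
  have h3 : 0 ≤ Real.log (1 + t) := Real.log_nonneg (by linarith)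
  have h4 : 0 ≤ t ^ s := by positivity
  rcases le_total t 1 with h | h
  · have := Real.rpow_le_one ht h hs
    have := mul_nonneg h4 h3
    linarith
  · have h5 : Real.log 2 ≤ Real.log (1 + t) := Real.log_le_log (by norm_num) (by linarith)
    have := Real.log_two_gt_d9
    nlinarith

theorem div_le_div_of_lt_neg_div (hr : 1 < r) (hp : 0 < p) (hα : 0 < p + β) (h : β < -p / r) :
    r / p ≤ (r - 1) / (p + β) := by
  rw [lt_div_iff₀ (by linarith)] at h
  rw [div_le_div_iff₀ hp hα]
  nlinarith

/-- In every regime `momentFun` dominates all powers up to r/p; this is how the moment condition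
controls truncated moments. -/
theorem rpow_le_momentFun (hr : 1 < r) (hp : 0 < p) (hα : 0 < p + β) {s t : ℝ} (ht : 0 ≤ t)
    (hs : 0 ≤ s) (hsq : s ≤ r / p) : t ^ s ≤ 2 * (1 + momentFun r p β t) := by
  refine (rpow_le_one_add_rpow hs hsq ht).trans ?_
  rcases lt_trichotomy β (-p / r) with h | h | h
  · rw [momentFun_of_lt h]
    have := rpow_le_one_add_rpow (div_pos (by linarith) hp).le (div_le_div_of_lt_neg_div hr hp hα h) ht
    have : 0 ≤ t ^ ((r - 1) / (p + β)) := by positivity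
    linarith
  · rw [momentFun_of_eq h]
    have := rpow_le_one_add_mul_log (div_pos (show 0 < r by linarith) hp).le ht
    linarith
  · rw [momentFun_of_gt h]
    have : 0 ≤ t ^ (r / p) := by positivity
    linarith

/-- For e = β(r-1)/(p+β) > -1 the sum of k^e over k ≤ U^{1/p} is of order U^{(e+1)/p}; the identity
gives the resulting total power of U. -/
theorem exponent_identity (hp : 0 < p) (hα : 0 < p + β) :
    (r - 1) / (p + β) + 1 / p * (β * ((r - 1) / (p + β)) + 1) = r / p := by
  field_simp; ring

theorem exponent_eq_neg_one (hr : 1 < r) (hp : 0 < p) (hα : 0 < p + β) (h : β = -p / r) :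
    β * ((r - 1) / (p + β)) = -1 ∧ (r - 1) / (p + β) = r / p := by
  have hr0 : 0 < r := by linarith
  have h2 : β * r = -p := by rw [h]; field_simp
  have h1 : β * ((r - 1) / (p + β)) = -1 := by
    field_simp; linarith
  refine ⟨h1, ?_⟩
  have := exponent_identity (r := r) hp hα
  rw [h1] at this
  linarith

theorem exponent_lt_neg_one (hr : 1 < r) (hα : 0 < p + β) (h : β < -p / r) :
    β * ((r - 1) / (p + β)) < -1 := by
  rw [lt_div_iff₀ (by linarith)] at h
  rw [← mul_div_assoc, div_lt_iff₀ hα]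
  linarith

theorem neg_one_lt_exponent (hr : 1 < r) (hα : 0 < p + β) (h : -p / r < β) :
    -1 < β * ((r - 1) / (p + β)) := by
  rw [div_lt_iff₀ (by linarith)] at h
  rw [← mul_div_assoc, lt_div_iff₀ hα]
  linarith

theorem sum_Icc_rpow_neg_one (N : ℕ) :
    ∑ k ∈ Icc 1 N, (k : ℝ) ^ (-1 : ℝ) = ((harmonic N : ℚ) : ℝ) := by
  rw [harmonic_eq_sum_Icc]
  push_cast
  exact sum_congr rfl fun k _ => Real.rpow_neg_one _

/-- The sum over k is bounded by a convergent series, a harmonic sum or a power according to the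
regime. In the harmonic case ln(1 + T/δ) is split into ln(1 + T) and a constant. -/
theorem exists_countBound_le_momentFun (hr : 1 < r) (hp : 0 < p) (hα : 0 < p + β) {δ : ℝ}
    (hδ : 0 < δ) :
    ∃ C C' : ℝ, 0 ≤ C ∧ 0 ≤ C' ∧ ∀ T : ℝ, 0 ≤ T →
      (T / δ) ^ ((r - 1) / (p + β)) *
        ∑ k ∈ Icc 1 ⌊(T / δ) ^ (1 / p)⌋₊, (k : ℝ) ^ (β * ((r - 1) / (p + β))) ≤
      C * momentFun r p β T + C' := by
  rcases lt_trichotomy β (-p / r) with h | h | h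
  · have he := exponent_lt_neg_one hr hα h
    have hsum := Real.summable_nat_rpow.2 he
    set e := β * ((r - 1) / (p + β)) with hedef
    refine ⟨(1 / δ) ^ ((r - 1) / (p + β)) * ∑' k : ℕ, (k : ℝ) ^ e, 0,
      mul_nonneg (by positivity) (tsum_nonneg fun k => by positivity), le_rfl, fun T hT => ?_⟩
    rw [momentFun_of_lt h, add_zero]
    calc _ ≤ (T / δ) ^ ((r - 1) / (p + β)) * ∑' k : ℕ, (k : ℝ) ^ e := by
          gcongr
          exact hsum.sum_le_tsum _ fun k _ => by positivity
      _ = _ := by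
          rw [div_eq_mul_one_div, Real.mul_rpow hT (by positivity)]; ring
  · obtain ⟨he, hτ⟩ := exponent_eq_neg_one hr hp hα h
    rw [he, hτ]
    have hlogδ : 0 ≤ Real.log (1 + 1 / δ) := Real.log_nonneg (by
      have : 0 < 1 / δ := by positivity
      linarith)
    set A := 1 + 1 / p * Real.log (1 + 1 / δ) with hA
    have hA0 : 0 ≤ A := by positivity
    refine ⟨(1 / δ) ^ (r / p) * (2 * A + 1 / p), (1 / δ) ^ (r / p) * A, by positivity,
      by positivity, fun T hT => ?_⟩
    rw [momentFun_of_eq h, sum_Icc_rpow_neg_one]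
    have hT1 := rpow_le_one_add_mul_log (div_pos (show 0 < r by linarith) hp).le hT
    have h1 : Real.log ⌊(T / δ) ^ (1 / p)⌋₊ ≤ 1 / p * Real.log (1 + T / δ) := by
      have hl : 0 ≤ Real.log (1 + T / δ) := Real.log_nonneg (by
        have : 0 ≤ T / δ := by positivity
        linarith)
      rcases Nat.eq_zero_or_pos ⌊(T / δ) ^ (1 / p)⌋₊ with h0 | h0
      · rw [h0]; simp; positivity
      · rw [← Real.log_rpow (by positivity)]
        refine Real.log_le_log (by exact_mod_cast h0) ((Nat.floor_le (by positivity)).trans ?_)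
        gcongr
        linarith
    have h2 : Real.log (1 + T / δ) ≤ Real.log (1 + T) + Real.log (1 + 1 / δ) := by
      rw [← Real.log_mul (by positivity) (by positivity)]
      refine Real.log_le_log (by positivity) ?_
      have : (1 + T) * (1 + 1 / δ) = 1 + T / δ + (T + 1 / δ) := by ring
      rw [this]
      have : 0 ≤ T + 1 / δ := by positivity
      linarith
    have h3 : ((harmonic ⌊(T / δ) ^ (1 / p)⌋₊ : ℚ) : ℝ) ≤ A + 1 / p * Real.log (1 + T) := by
      refine (harmonic_le_one_add_log _).trans ?_
      have := mul_le_mul_of_nonneg_left h2 (show 0 ≤ 1 / p by positivity)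
      linarith
    have hδq : 0 ≤ (1 / δ) ^ (r / p) := by positivity
    calc _ ≤ (T / δ) ^ (r / p) * (A + 1 / p * Real.log (1 + T)) := by gcongr
      _ = (1 / δ) ^ (r / p) * (A * T ^ (r / p) + 1 / p * (T ^ (r / p) * Real.log (1 + T))) := by
          rw [div_eq_mul_one_div T, Real.mul_rpow hT (by positivity)]; ring
      _ ≤ (1 / δ) ^ (r / p) * (A * (1 + 2 * (T ^ (r / p) * Real.log (1 + T))) +
          1 / p * (T ^ (r / p) * Real.log (1 + T))) := by gcongr
      _ = _ := by ring
  · have he := neg_one_lt_exponent hr hα h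
    set e := β * ((r - 1) / (p + β)) with hedef
    obtain ⟨C, hC, hsum⟩ := exists_sum_rpow_sub_one_le (γ := e + 1) (by linarith)
    refine ⟨C * (1 / δ) ^ (r / p), 0, by positivity, le_rfl, fun T hT => ?_⟩
    rw [momentFun_of_gt h, add_zero]
    have hq : 0 < r / p := div_pos (by linarith) hp
    rcases hT.eq_or_lt with rfl | hT'
    · have : (r - 1) / (p + β) ≠ 0 := (div_pos (by linarith) hα).ne'
      simp [Real.zero_rpow this, Real.zero_rpow hq.ne']
    have hU : 0 < T / δ := by positivity
    calc _ ≤ (T / δ) ^ ((r - 1) / (p + β)) * (C * ((T / δ) ^ (1 / p)) ^ (e + 1)) := by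
          gcongr
          have := hsum ((T / δ) ^ (1 / p)) (by positivity)
          rwa [add_sub_cancel_right] at this
      _ = C * (T / δ) ^ (r / p) := by
          rw [← Real.rpow_mul hU.le, mul_left_comm, ← Real.rpow_add hU, exponent_identity hp hα]
      _ = _ := by rw [div_eq_mul_one_div T, Real.mul_rpow hT (by positivity)]; ring

/-- Large T suffice, since by monotonicity the value at T₀ serves as additive constant below T₀. -/
theorem exists_momentFun_le_countBound (hr : 1 < r) (hp : 0 < p) (hα : 0 < p + β) :
    ∃ C C' : ℝ, 0 ≤ C ∧ 0 ≤ C' ∧ ∀ T : ℝ, 0 ≤ T → momentFun r p β T ≤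
      C * (T ^ ((r - 1) / (p + β)) * ∑ k ∈ Icc 1 ⌊T ^ (1 / p) / 4 ^ ((p + β) / p)⌋₊,
        (k : ℝ) ^ (β * ((r - 1) / (p + β)))) + C' := by
  suffices h : ∃ C T₀ : ℝ, 0 ≤ C ∧ 0 ≤ T₀ ∧ ∀ T : ℝ, T₀ ≤ T → momentFun r p β T ≤
      C * (T ^ ((r - 1) / (p + β)) * ∑ k ∈ Icc 1 ⌊T ^ (1 / p) / 4 ^ ((p + β) / p)⌋₊,
        (k : ℝ) ^ (β * ((r - 1) / (p + β)))) by
    obtain ⟨C, T₀, hC, hT₀, h⟩ := h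
    refine ⟨C, momentFun r p β T₀, hC, momentFun_nonneg hT₀, fun T hT => ?_⟩
    rcases le_total T₀ T with h1 | h1
    · have := momentFun_nonneg (r := r) (p := p) (β := β) hT₀
      have := h T h1
      linarith
    · have h2 := momentFun_monotoneOn hr hp hα hT hT₀ h1
      refine h2.trans (le_add_of_nonneg_left ?_)
      exact mul_nonneg hC (mul_nonneg (by positivity) (sum_nonneg fun k _ => by positivity))
  have hK : ∀ x T : ℝ, 0 ≤ x → (x * 4 ^ ((p + β) / p)) ^ p ≤ T →
      x ≤ T ^ (1 / p) / 4 ^ ((p + β) / p) := by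
    intro x T hx hT
    rw [le_div_iff₀ (by positivity)]
    have h1 := Real.rpow_le_rpow (by positivity) hT (show 0 ≤ 1 / p by positivity)
    rwa [← Real.rpow_mul (by positivity), mul_one_div_cancel hp.ne', Real.rpow_one] at h1
  rcases lt_trichotomy β (-p / r) with h | h | h
  · refine ⟨1, (1 * 4 ^ ((p + β) / p)) ^ p, zero_le_one, by positivity, fun T hT => ?_⟩
    have hT0 : 0 ≤ T := le_trans (by positivity) hT
    rw [momentFun_of_lt h, one_mul]
    refine le_mul_of_one_le_right (by positivity) ?_
    have h1 : 1 ∈ Icc 1 ⌊T ^ (1 / p) / 4 ^ ((p + β) / p)⌋₊ :=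
      mem_Icc.2 ⟨le_rfl, Nat.le_floor (by simpa using hK 1 T zero_le_one hT)⟩
    have := single_le_sum (f := fun k : ℕ => (k : ℝ) ^ (β * ((r - 1) / (p + β))))
      (fun k _ => by positivity) h1
    simpa using this
  · obtain ⟨he, hτ⟩ := exponent_eq_neg_one hr hp hα h
    rw [he, hτ]
    -- T ≥ 4^{2(p+β)} makes the constant in ln K at most half of ln T, so ln K ≥ ln T / (2p); T ≥ 2
    -- gives ln(1 + T) ≤ 2 ln T. Together these produce 4p.
    refine ⟨4 * p, max 2 ((4 ^ (p + β)) ^ 2), by positivity, by positivity, fun T hT => ?_⟩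
    have hT2 : 2 ≤ T := (le_max_left _ _).trans hT
    have hT3 : ((4 : ℝ) ^ (p + β)) ^ 2 ≤ T := (le_max_right _ _).trans hT
    have hT0 : 0 < T := by linarith
    rw [momentFun_of_eq h, sum_Icc_rpow_neg_one]
    set K := T ^ (1 / p) / 4 ^ ((p + β) / p) with hKdef
    have hK0 : 0 < K := by positivity
    have h1 : Real.log K ≤ ((harmonic ⌊K⌋₊ : ℚ) : ℝ) := by
      refine le_trans (Real.log_le_log hK0 ?_) (log_add_one_le_harmonic ⌊K⌋₊)
      push_cast
      exact (Nat.lt_floor_add_one K).le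
    have h2 : Real.log K = 1 / p * (Real.log T - (p + β) * Real.log 4) := by
      rw [hKdef, Real.log_div (by positivity) (by positivity), Real.log_rpow hT0,
        Real.log_rpow (by norm_num)]
      ring
    have h3 : 2 * ((p + β) * Real.log 4) ≤ Real.log T := by
      have := Real.log_le_log (by positivity) hT3
      rwa [Real.log_pow, Real.log_rpow (by norm_num)] at this
    have h4 : Real.log (1 + T) ≤ 2 * Real.log T := by
      have : Real.log (1 + T) ≤ Real.log (T ^ 2) := Real.log_le_log (by positivity) (by nlinarith)
      rwa [Real.log_pow] at this
    have h5 : Real.log (1 + T) ≤ 4 * p * ((harmonic ⌊K⌋₊ : ℚ) : ℝ) := by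
      have h6 : 4 * p * Real.log K = 4 * (Real.log T - (p + β) * Real.log 4) := by
        rw [h2]; field_simp
      have h7 := mul_le_mul_of_nonneg_left h1 (show 0 ≤ 4 * p by positivity)
      linarith
    have := mul_le_mul_of_nonneg_left h5 (show 0 ≤ T ^ (r / p) by positivity)
    linarith
  · set e := β * ((r - 1) / (p + β)) with hedef
    obtain ⟨c, hc, hsum⟩ := exists_le_sum_Ioc_rpow e
    set L : ℝ := 4 ^ ((p + β) / p) with hL
    have hL0 : 0 < L := by positivity
    -- T ≥ (4L)^p means K ≥ 4, as the block estimate requires.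
    refine ⟨L ^ (e + 1) / c, (4 * L) ^ p, by positivity, by positivity, fun T hT => ?_⟩
    have hT0 : 0 < T := lt_of_lt_of_le (by positivity) hT
    rw [momentFun_of_gt h]
    have h1 := hsum _ (hK 4 T (by norm_num) hT)
    set K := T ^ (1 / p) / L with hKdef
    have h2 : ∑ n ∈ Ioc ⌊K / 2⌋₊ ⌊K⌋₊, (n : ℝ) ^ e ≤ ∑ n ∈ Icc 1 ⌊K⌋₊, (n : ℝ) ^ e := by
      refine sum_le_sum_of_subset_of_nonneg (fun n hn => ?_) fun n _ _ => by positivity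
      rw [mem_Ioc] at hn
      rw [mem_Icc]; omega
    calc T ^ (r / p) = L ^ (e + 1) / c * (T ^ ((r - 1) / (p + β)) * (c * K ^ (e + 1))) := by
          rw [hKdef, Real.div_rpow (by positivity) hL0.le, ← Real.rpow_mul hT0.le,
            ← exponent_identity (β := β) hp hα, ← hedef, Real.rpow_add hT0]
          have hLe : 0 < L ^ (e + 1) := by positivity
          generalize T ^ (1 / p * (e + 1)) = b
          generalize T ^ ((r - 1) / (p + β)) = a
          field_simp
      _ ≤ _ := by gcongr; exact h1.trans h2

end

/-- Power sums of the weights `k^β n^{-α}` decay polynomially. -/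
theorem exists_sum_weight_rpow_le {p β s : ℝ} (hα : 0 < p + β) (hs : 0 < s) (hps : 1 < p * s) :
    ∃ K γ : ℝ, 0 < K ∧ 0 < γ ∧ ∀ n : ℕ, 1 ≤ n →
      ∑ k ∈ Ico 1 n, ((k : ℝ) ^ β * (n : ℝ) ^ (-(p + β))) ^ s ≤ K * (n : ℝ) ^ (-γ) := by
  set α := p + β with hαdef
  -- Half of the available decay is kept; the other half pays for the logarithm of a harmonic sum.
  set γ := min (p * s - 1) (α * s) / 2 with hγdef
  have hγ : 0 < γ := by
    have : 0 < min (p * s - 1) (α * s) := lt_min (by linarith) (by positivity)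
    positivity
  have hγ1 : 2 * γ ≤ p * s - 1 := by rw [hγdef]; linarith [min_le_left (p * s - 1) (α * s)]
  have hγ2 : 2 * γ ≤ α * s := by rw [hγdef]; linarith [min_le_right (p * s - 1) (α * s)]
  refine ⟨2 * (1 + 1 / γ), γ, by positivity, hγ, fun n hn => ?_⟩
  have hn1 : (1 : ℝ) ≤ n := by exact_mod_cast hn
  have hn0 : (0 : ℝ) < n := by linarith
  -- Splitting off k^{-1} and bounding k^{1+βs} by n^{1+βs} + 1 treats all signs of 1 + βs at once.
  have hterm : ∀ k ∈ Ico 1 n, ((k : ℝ) ^ β * (n : ℝ) ^ (-α)) ^ s ≤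
      (n : ℝ) ^ (-(α * s)) * ((n : ℝ) ^ (1 + β * s) + 1) * (k : ℝ) ^ (-1 : ℝ) := by
    intro k hk
    obtain ⟨hk1, hk2⟩ := mem_Ico.1 hk
    have hk1' : (1 : ℝ) ≤ k := by exact_mod_cast hk1
    have hk0 : (0 : ℝ) < k := by linarith
    have hkn : (k : ℝ) ≤ n := by exact_mod_cast hk2.le
    have h1 : (k : ℝ) ^ (1 + β * s) ≤ (n : ℝ) ^ (1 + β * s) + 1 := by
      rcases le_total 0 (1 + β * s) with h | h
      · have := Real.rpow_le_rpow hk0.le hkn h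
        linarith
      · have := Real.rpow_le_one_of_one_le_of_nonpos hk1' h
        have : 0 ≤ (n : ℝ) ^ (1 + β * s) := by positivity
        linarith
    calc _ = (n : ℝ) ^ (-(α * s)) * (k : ℝ) ^ (1 + β * s) * (k : ℝ) ^ (-1 : ℝ) := by
          rw [Real.mul_rpow (by positivity) (by positivity), ← Real.rpow_mul hk0.le,
            ← Real.rpow_mul hn0.le, mul_assoc, ← Real.rpow_add hk0]
          ring_nf
      _ ≤ _ := by gcongr
  have hharm : ∑ k ∈ Ico 1 n, (k : ℝ) ^ (-1 : ℝ) ≤ (1 + 1 / γ) * (n : ℝ) ^ γ := by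
    calc _ ≤ ∑ k ∈ Icc 1 n, (k : ℝ) ^ (-1 : ℝ) :=
          sum_le_sum_of_subset_of_nonneg Ico_subset_Icc_self fun k _ _ => by positivity
      _ ≤ 1 + Real.log n := by rw [sum_Icc_rpow_neg_one]; exact harmonic_le_one_add_log n
      _ ≤ (n : ℝ) ^ γ + (n : ℝ) ^ γ / γ :=
          add_le_add (Real.one_le_rpow hn1 hγ.le) (Real.log_le_rpow_div hn0.le hγ)
      _ = _ := by ring
  calc _ ≤ ∑ k ∈ Ico 1 n,
          (n : ℝ) ^ (-(α * s)) * ((n : ℝ) ^ (1 + β * s) + 1) * (k : ℝ) ^ (-1 : ℝ) :=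
        sum_le_sum hterm
    _ = (n : ℝ) ^ (-(α * s)) * ((n : ℝ) ^ (1 + β * s) + 1) *
          ∑ k ∈ Ico 1 n, (k : ℝ) ^ (-1 : ℝ) := by rw [mul_sum]
    _ ≤ (n : ℝ) ^ (-(α * s)) * ((n : ℝ) ^ (1 + β * s) + 1) * ((1 + 1 / γ) * (n : ℝ) ^ γ) := by
        gcongr
    _ = (1 + 1 / γ) * ((n : ℝ) ^ (1 - p * s + γ) + (n : ℝ) ^ (-(α * s) + γ)) := by
        have e1 : (n : ℝ) ^ (1 - p * s + γ) =
            (n : ℝ) ^ (-(α * s)) * (n : ℝ) ^ (1 + β * s) * (n : ℝ) ^ γ := by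
          rw [← Real.rpow_add hn0, ← Real.rpow_add hn0]
          congr 1
          rw [hαdef]; ring
        rw [e1, Real.rpow_add hn0 (-(α * s))]
        ring
    _ ≤ (1 + 1 / γ) * ((n : ℝ) ^ (-γ) + (n : ℝ) ^ (-γ)) := by
        gcongr <;> linarith
    _ = _ := by ring
end

/-! ### Truncation and truncated moments. -/

noncomputable section

open Finset

theorem tsum_pairWeight_mul (r : ℝ) (F : ℕ × ℕ → ℝ≥0∞) :
    ∑' z, pairWeight r z * F z =
      ∑' n : ℕ, ENNReal.ofReal ((n : ℝ) ^ (r - 2)) * ∑ k ∈ Ico 1 n, F (k, n) := by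
  rw [ENNReal.tsum_prod', ENNReal.tsum_comm]
  refine tsum_congr fun n => ?_
  rw [tsum_eq_sum (s := Ico 1 n), mul_sum]
  · refine sum_congr rfl fun k hk => ?_
    rw [pairWeight, if_pos (mem_Ico.1 hk)]
  · intro k hk
    rw [pairWeight, if_neg (fun h => hk (mem_Ico.2 h)), zero_mul]

theorem array_weight_eq {p β : ℝ} {n i : ℕ} (hi : i < n) :
    (((n : ℝ) - (i : ℝ)) / (n : ℝ)) ^ β * (1 / (n : ℝ)) ^ p =
      ((n - i : ℕ) : ℝ) ^ β * (n : ℝ) ^ (-(p + β)) := by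
  have hn : (0 : ℝ) < n := by exact_mod_cast (Nat.zero_le i).trans_lt hi
  rw [← Nat.cast_sub hi.le, Real.div_rpow (Nat.cast_nonneg _) hn.le, one_div,
    Real.inv_rpow hn.le, Real.rpow_neg hn.le, Real.rpow_add hn]
  field_simp

theorem sum_Icc_comp_sub (n : ℕ) {M : Type*} [AddCommMonoid M] (f : ℕ → M) :
    ∑ i ∈ Icc 1 (n - 1), f (n - i) = ∑ k ∈ Ico 1 n, f k := by
  refine sum_nbij' (fun i => n - i) (fun k => n - k) ?_ ?_ ?_ ?_ ?_
  · intro i hi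
    rw [mem_Icc] at hi
    rw [mem_Ico]; omega
  · intro i hi
    rw [mem_Ico] at hi
    rw [mem_Icc]; omega
  · intro i hi
    rw [mem_Icc] at hi
    omega
  · intro i hi
    rw [mem_Ico] at hi
    omega
  · exact fun _ _ => rfl

/-- Truncation of `x` to `[-d, d]`. -/
def clip (d x : ℝ) : ℝ := max (-d) (min x d)

theorem lipschitzWith_clip (d : ℝ) : LipschitzWith 1 (clip d) :=
  (LipschitzWith.id.min_const d).const_max (-d)

theorem measurable_clip (d : ℝ) : Measurable (clip d) := (lipschitzWith_clip d).continuous.measurable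

theorem abs_clip {d : ℝ} (hd : 0 ≤ d) (x : ℝ) : |clip d x| = min |x| d := by
  unfold clip
  rcases le_total x 0 with h | h
  · rw [min_eq_left (h.trans hd), abs_of_nonpos (max_le (by linarith) h), abs_of_nonpos h]
    rcases le_total (-d) x with h1 | h1
    · rw [max_eq_right h1, min_eq_left (by linarith)]
    · rw [max_eq_left h1, min_eq_right (by linarith), neg_neg]
  · have : 0 ≤ min x d := le_min h hd
    rw [max_eq_right (by linarith), abs_of_nonneg this, abs_of_nonneg h]

theorem abs_clip_le {d : ℝ} (hd : 0 ≤ d) (x : ℝ) : |clip d x| ≤ d :=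
  (abs_clip hd x).le.trans (min_le_right _ _)

theorem clip_eq_self {d x : ℝ} (h : |x| ≤ d) : clip d x = x := by
  obtain ⟨h1, h2⟩ := abs_le.1 h
  rw [clip, min_eq_left h2, max_eq_right h1]

theorem clip_sub_le {d : ℝ} (x : ℝ) : clip d x - x ≤ max (|x| - d) 0 := by
  unfold clip
  have := neg_abs_le x
  rcases max_cases (-d) (min x d) with ⟨h, -⟩ | ⟨h, -⟩ <;> rw [h]
  · exact le_max_of_le_left (by linarith)
  · exact le_max_of_le_right (by linarith [min_le_left x d])

/-- Interpolation: u - s powers are bounded by the truncation level, the other s by |x|. -/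
theorem min_abs_rpow_le {d s u x : ℝ} (hd : 0 < d) (hs : 0 < s) (hsu : s ≤ u) :
    min |x| d ^ u ≤ d ^ (u - s) * |x| ^ s := by
  have h0 : 0 ≤ min |x| d := le_min (abs_nonneg x) hd.le
  calc min |x| d ^ u = min |x| d ^ (u - s) * min |x| d ^ s := by
        rw [← Real.rpow_add_of_nonneg h0 (by linarith) hs.le]; ring_nf
    _ ≤ _ := by
        gcongr
        · exact min_le_right _ _
        · exact min_le_left _ _

theorem max_abs_sub_le {d s x : ℝ} (hd : 0 < d) (hs : 1 ≤ s) :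
    max (|x| - d) 0 ≤ d ^ (1 - s) * |x| ^ s := by
  refine max_le ?_ (by positivity)
  rcases le_total |x| d with h | h
  · have : 0 ≤ d ^ (1 - s) * |x| ^ s := by positivity
    linarith
  · have hx : 0 < |x| := hd.trans_le h
    calc |x| - d ≤ |x| := by linarith
      _ = |x| ^ (1 - s) * |x| ^ s := by rw [← Real.rpow_add hx]; simp
      _ ≤ _ := by
        have := Real.rpow_le_rpow_of_nonpos hd h (show 1 - s ≤ 0 by linarith)
        exact mul_le_mul_of_nonneg_right this (by positivity)

namespace SublinearExpectation

variable {Ω : Type*} [MeasurableSpace Ω] {S : SublinearExpectation Ω}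

theorem isBdd_clip {Y : Ω → ℝ} (hY : Y ∈ S.H) {d : ℝ} (hd : 0 ≤ d) (A : ℝ) :
    S.IsBdd (fun ω => clip d (A * Y ω)) :=
  ⟨S.lipschitz_comp_mem (lipschitzWith_clip d) (S.const_mul_mem A hY), d,
    fun _ => abs_clip_le hd _⟩

theorem abs_mem {Y : Ω → ℝ} (hY : Y ∈ S.H) : (fun ω => |Y ω|) ∈ S.H :=
  S.lipschitz_comp_mem (f := fun x => |x|) (LipschitzWith.of_dist_le_mul fun x y => by
    simpa [Real.dist_eq] using abs_abs_sub_abs_le x y) hY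

variable {X : Ω → ℝ} {r p β : ℝ}

theorem abs_mul_rpow_le (hr : 1 < r) (hp : 0 < p) (hα : 0 < p + β) {s : ℝ} (hs : 0 < s)
    (hsq : s ≤ r / p) {A c : ℝ} (hA : 0 ≤ A) (hc : 0 ≤ c) (x : ℝ) :
    c * |A * x| ^ s ≤ c * A ^ s * 2 * (1 + momentFun r p β |x|) := by
  rw [abs_mul, abs_of_nonneg hA, Real.mul_rpow hA (abs_nonneg x)]
  have := rpow_le_momentFun (β := β) hr hp hα (abs_nonneg x) hs.le hsq
  have h2 : 0 ≤ c * A ^ s := by positivity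
  nlinarith

/-- The truncated square is at most d^{2-s}|AX|^s, and |X|^s is dominated by the moment function. -/
theorem CountablySubadditive.exists_ev_clip_sq_le (hS : S.CountablySubadditive) (hX : X ∈ S.H)
    (hr : 1 < r) (hp : 0 < p) (hα : 0 < p + β)
    (hfin : ∫⁻ y in Set.Ioi (0 : ℝ), S.capacity {ω | y < momentFun r p β |X ω|} < ⊤)
    {s : ℝ} (hs : 0 < s) (hsq : s ≤ r / p) (hs2 : s ≤ 2) {d : ℝ} (hd : 0 < d) :
    ∃ M : ℝ, 0 ≤ M ∧ ∀ A : ℝ, 0 ≤ A → S.ev (fun ω => clip d (A * X ω) ^ 2) ≤ M * A ^ s := by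
  obtain ⟨D, hD, hE⟩ := hS.exists_E_le hfin
  refine ⟨d ^ (2 - s) * 2 * D, by positivity, fun A hA => ?_⟩
  rcases hA.eq_or_lt with rfl | hA'
  -- A = 0 is treated apart because `exists_E_le` needs a positive factor K.
  · have : ∀ ω, clip d (0 * X ω) ^ 2 = 0 := fun ω => by
      rw [zero_mul, clip_eq_self (by simpa using hd.le)]; simp
    simp only [this, ev_const, Real.zero_rpow hs.ne', mul_zero, le_refl]
  have hb : S.IsBdd (fun ω => clip d (A * X ω) ^ 2) := by
    simpa [sq] using (isBdd_clip hX hd.le A).mul (isBdd_clip hX hd.le A)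
  have := hE _ hb.1 (fun ω => sq_nonneg _) (d ^ (2 - s) * A ^ s * 2) (by positivity) fun ω => by
    refine le_trans ?_ (abs_mul_rpow_le hr hp hα hs hsq hA (by positivity) (X ω))
    have h1 := min_abs_rpow_le (x := A * X ω) hd hs hs2
    rw [← abs_clip hd.le, Real.rpow_two, sq_abs] at h1
    exact h1
  rw [← hb.coe_ev, EReal.coe_le_coe_iff] at this
  linarith

theorem CountablySubadditive.exists_ev_abs_clip_le (hS : S.CountablySubadditive) (hX : X ∈ S.H)
    (hr : 1 < r) (hp : 0 < p) (hα : 0 < p + β)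
    (hfin : ∫⁻ y in Set.Ioi (0 : ℝ), S.capacity {ω | y < momentFun r p β |X ω|} < ⊤)
    {s : ℝ} (hs : 0 < s) (hsq : s ≤ r / p) (hs1 : s ≤ 1) {d : ℝ} (hd : 0 < d) :
    ∃ M : ℝ, 0 ≤ M ∧ ∀ A : ℝ, 0 ≤ A → S.ev (fun ω => clip d (A * X ω)) ≤ M * A ^ s := by
  obtain ⟨D, hD, hE⟩ := hS.exists_E_le hfin
  refine ⟨d ^ (1 - s) * 2 * D, by positivity, fun A hA => ?_⟩
  rcases hA.eq_or_lt with rfl | hA'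
  · have : ∀ ω, clip d (0 * X ω) = 0 := fun ω => by
      rw [zero_mul, clip_eq_self (by simpa using hd.le)]
    simp only [this, ev_const, Real.zero_rpow hs.ne', mul_zero, le_refl]
  have hb := isBdd_clip hX hd.le A
  have hb' : S.IsBdd (fun ω => |clip d (A * X ω)|) :=
    ⟨abs_mem hb.1, d, fun ω => by rw [abs_abs]; exact abs_clip_le hd.le _⟩
  have := hE _ hb'.1 (fun ω => abs_nonneg _) (d ^ (1 - s) * A ^ s * 2) (by positivity) fun ω => by
    refine le_trans ?_ (abs_mul_rpow_le hr hp hα hs hsq hA (by positivity) (X ω))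
    have h1 := min_abs_rpow_le (x := A * X ω) hd hs hs1
    rw [← abs_clip hd.le, Real.rpow_one] at h1
    exact h1
  rw [← hb'.coe_ev, EReal.coe_le_coe_iff] at this
  have h2 := ev_mono hb hb' fun ω => le_abs_self _
  linarith

/-- Truncation changes AX by at most (|AX| - d)^+, which is bounded by d^{1-s}|AX|^s for s ≥ 1; AX
itself has expectation 0. -/
theorem CountablySubadditive.exists_ev_clip_le_of_mean_zero (hS : S.CountablySubadditive)
    (hX : X ∈ S.H) (hr : 1 < r) (hp : 0 < p) (hα : 0 < p + β)
    (hfin : ∫⁻ y in Set.Ioi (0 : ℝ), S.capacity {ω | y < momentFun r p β |X ω|} < ⊤)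
    (hmean : S.E X = 0) {s : ℝ} (hs1 : 1 ≤ s) (hsq : s ≤ r / p) {d : ℝ} (hd : 0 < d) :
    ∃ M : ℝ, 0 ≤ M ∧ ∀ A : ℝ, 0 ≤ A → S.ev (fun ω => clip d (A * X ω)) ≤ M * A ^ s := by
  obtain ⟨D, hD, hE⟩ := hS.exists_E_le hfin
  have hs : 0 < s := by linarith
  refine ⟨d ^ (1 - s) * 2 * D, by positivity, fun A hA => ?_⟩
  rcases hA.eq_or_lt with rfl | hA'
  · have : ∀ ω, clip d (0 * X ω) = 0 := fun ω => by
      rw [zero_mul, clip_eq_self (by simpa using hd.le)]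
    simp only [this, ev_const, Real.zero_rpow hs.ne', mul_zero, le_refl]
  have hb := isBdd_clip hX hd.le A
  have hAX := S.const_mul_mem A hX
  have hξ : (fun ω => max (|A * X ω| - d) 0) ∈ S.H :=
    S.lipschitz_comp_mem (f := fun x => max x 0) (LipschitzWith.id.max_const 0)
      (by simpa [sub_eq_add_neg] using S.add_mem (abs_mem hAX) (S.const_mem (-d)))
  have h1 := hE _ hξ (fun ω => le_max_right _ _) (d ^ (1 - s) * A ^ s * 2) (by positivity) fun ω =>
    (max_abs_sub_le hd hs1).trans (abs_mul_rpow_le hr hp hα hs hsq hA (by positivity) (X ω))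
  have h2 : S.E (fun ω => A * X ω) = 0 := by rw [S.pos_homog _ hX A hA, hmean, mul_zero]
  have h3 : S.E (fun ω => clip d (A * X ω)) ≤
      S.E (fun ω => A * X ω + max (|A * X ω| - d) 0) :=
    S.mono _ (S.add_mem hAX hξ) _ hb.1 fun ω => by
      have := clip_sub_le (d := d) (A * X ω)
      linarith
  have h4 := h3.trans (S.subadd _ hAX _ hξ (fun h => by rw [h2] at h; exact absurd h.1 (by simp))
    (fun h => by rw [h2] at h; exact absurd h.1 (by simp)))
  rw [h2, zero_add] at h4
  have h5 := h4.trans h1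
  rw [← hb.coe_ev, EReal.coe_le_coe_iff] at h5
  linarith

/-- The truncated means are of smaller order: a power `s` of the weight with `p s > 1`. -/
theorem CountablySubadditive.exists_ev_clip_le (hS : S.CountablySubadditive)
    (hX : X ∈ S.H) (hr : 1 < r) (hp : 0 < p) (hα : 0 < p + β)
    (hfin : ∫⁻ y in Set.Ioi (0 : ℝ), S.capacity {ω | y < momentFun r p β |X ω|} < ⊤)
    (hmean : p ≤ 1 → S.E X = 0) {d : ℝ} (hd : 0 < d) :
    ∃ M : ℝ, 0 ≤ M ∧ ∀ A : ℝ, 0 ≤ A →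
      S.ev (fun ω => clip d (A * X ω)) ≤ M * A ^ (if p ≤ 1 then r / p else min 1 (r / p)) := by
  -- For p ≤ 1 centering allows s = r/p ≥ 1, with p s = r. For p > 1 no centering is available, but
  -- s = min(1, r/p) still gives p s = min(p, r) > 1.
  split_ifs with h
  · refine hS.exists_ev_clip_le_of_mean_zero hX hr hp hα hfin (hmean h) ?_ le_rfl hd
    rw [one_le_div hp]; linarith
  · exact hS.exists_ev_abs_clip_le hX hr hp hα hfin (lt_min one_pos (div_pos (by linarith) hp))
      (min_le_right _ _) (min_le_left _ _) hd

end SublinearExpectation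
end

/-! ### The moment condition implies complete convergence. -/

noncomputable section

open Finset

theorem ArrayApprox.exists_bounds {a : ℕ → ℕ → ℝ} {p β : ℝ}
    (ha : ArrayApprox a
      (fun n i => (((n : ℝ) - (i : ℝ)) / (n : ℝ)) ^ β * (1 / (n : ℝ)) ^ p)) :
    ∃ c C : ℝ, 0 < c ∧ 0 < C ∧ ∃ N : ℕ, ∀ n ≥ N, ∀ i < n,
      c * (((n - i : ℕ) : ℝ) ^ β * (n : ℝ) ^ (-(p + β))) ≤ a n i ∧
      a n i ≤ C * (((n - i : ℕ) : ℝ) ^ β * (n : ℝ) ^ (-(p + β))) := by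
  obtain ⟨c, C, hc, hC, N, h⟩ := ha
  refine ⟨c, C, hc, hC, N, fun n hn i hi => ?_⟩
  have := h n hn i hi
  simp only [array_weight_eq hi] at this
  exact this

theorem sum_array_rpow_le {a : ℕ → ℕ → ℝ} {p β C s : ℝ} {n : ℕ} (hC : 0 < C) (hs : 0 < s)
    (ha : ∀ i < n, 0 ≤ a n i ∧ a n i ≤ C * (((n - i : ℕ) : ℝ) ^ β * (n : ℝ) ^ (-(p + β)))) :
    ∑ i ∈ Icc 1 (n - 1), (if i < n then a n i else 0) ^ s ≤
      C ^ s * ∑ k ∈ Ico 1 n, ((k : ℝ) ^ β * (n : ℝ) ^ (-(p + β))) ^ s := by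
  rw [← sum_Icc_comp_sub n (fun k : ℕ => ((k : ℝ) ^ β * (n : ℝ) ^ (-(p + β))) ^ s), mul_sum]
  refine sum_le_sum fun i hi => ?_
  have hi' : i < n := by rw [mem_Icc] at hi; omega
  rw [if_pos hi', ← Real.mul_rpow hC.le (by positivity)]
  exact Real.rpow_le_rpow (ha i hi').1 (ha i hi').2 hs.le

/-- With `l = 2 r ln n / ε` the exponential bound is a multiple of `n^{-r}`. -/
theorem exp_bound_le {r ε d γ K n m b : ℝ} (hr : 0 < r) (hε : 0 < ε)
    (hγ : 0 < γ) (hdγ : 4 * r * d ≤ γ * ε) (hn : 1 ≤ n) (hm : m ≤ ε / 2)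
    (hb0 : 0 ≤ b) (hb : b ≤ K * n ^ (-γ)) :
    Real.exp (-(2 * r * Real.log n / ε) * ε + 2 * r * Real.log n / ε * m +
      (2 * r * Real.log n / ε) ^ 2 * Real.exp (2 * r * Real.log n / ε * d) * b) ≤
    Real.exp ((2 * r / ε) ^ 2 * (4 / γ) ^ 2 * K) * n ^ (-r) := by
  have hn0 : 0 < n := by linarith
  have hlog : 0 ≤ Real.log n := Real.log_nonneg hn
  set l := 2 * r * Real.log n / ε with hl
  have hl0 : 0 ≤ l := by positivity
  have h1 : n ^ (-r) = Real.exp (-(l * ε) + l * (ε / 2)) := by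
    rw [Real.rpow_def_of_pos hn0, hl]
    congr 1
    field_simp; ring
  have h2 : l * m ≤ l * (ε / 2) := by gcongr
  -- The decay n^{-γ} of b is spent in halves: one on e^{ld}, whose exponent is (2rd/ε) ln n with
  -- 2rd/ε ≤ γ/2, and one on l², a multiple of (ln n)².
  have h3 : Real.exp (l * d) ≤ n ^ (γ / 2) := by
    rw [Real.rpow_def_of_pos hn0, Real.exp_le_exp, hl, div_mul_eq_mul_div, div_le_iff₀ hε]
    nlinarith
  have h4 : Real.log n ≤ n ^ (γ / 4) / (γ / 4) := Real.log_le_rpow_div hn0.le (by positivity)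
  have h5 : l ^ 2 ≤ (2 * r / ε) ^ 2 * (4 / γ) ^ 2 * n ^ (γ / 2) := by
    have : l ≤ (2 * r / ε) * ((4 / γ) * n ^ (γ / 4)) := by
      calc l = (2 * r / ε) * Real.log n := by rw [hl]; ring
        _ ≤ (2 * r / ε) * (n ^ (γ / 4) / (γ / 4)) := by gcongr
        _ = _ := by field_simp
    calc l ^ 2 ≤ ((2 * r / ε) * ((4 / γ) * n ^ (γ / 4))) ^ 2 := by gcongr
      _ = (2 * r / ε) ^ 2 * (4 / γ) ^ 2 * (n ^ (γ / 4)) ^ 2 := by ring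
      _ = _ := by
        rw [← Real.rpow_natCast (n ^ (γ / 4)), ← Real.rpow_mul hn0.le]
        congr 2
        push_cast; ring
  have h6 : l ^ 2 * Real.exp (l * d) * b ≤ (2 * r / ε) ^ 2 * (4 / γ) ^ 2 * K := by
    calc _ ≤ ((2 * r / ε) ^ 2 * (4 / γ) ^ 2 * n ^ (γ / 2)) * n ^ (γ / 2) * (K * n ^ (-γ)) := by
          gcongr
      _ = (2 * r / ε) ^ 2 * (4 / γ) ^ 2 * K * (n ^ (γ / 2) * n ^ (γ / 2) * n ^ (-γ)) := by ring
      _ = _ := by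
          rw [← Real.rpow_add hn0, ← Real.rpow_add hn0]
          simp
  rw [h1, ← Real.exp_add, Real.exp_le_exp]
  linarith

namespace SublinearExpectation

variable {Ω : Type*} [MeasurableSpace Ω] {S : SublinearExpectation Ω}

/-- One-sided bound for the sums truncated at d; τ = 1 and τ = -1 together control the absolute
value. The truncated means sum to o(1), hence eventually to at most ε/2, and the second moments to
O(n^{-γ}), so `exp_bound_le` applies. -/
theorem exists_capacity_clip_sum_le (hS : S.CountablySubadditive)
    {X : Ω → ℝ} {Xs : ℕ → Ω → ℝ} (hX : X ∈ S.H) (hXs : ∀ n, 1 ≤ n → Xs n ∈ S.H)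
    (hindep : S.IndepSeq Xs) (hident : ∀ n, 1 ≤ n → S.IdentDistrib (Xs n) X)
    {r p β : ℝ} (hr : 1 < r) (hp : 1 / 2 < p) (hα : 0 < p + β)
    (hfin : ∫⁻ y in Set.Ioi (0 : ℝ), S.capacity {ω | y < momentFun r p β |X ω|} < ⊤)
    {τ : ℝ} (hτ : |τ| = 1) (hmean : p ≤ 1 → S.E (fun ω => τ * X ω) = 0)
    {a : ℕ → ℕ → ℝ} {C : ℝ} (hC : 0 < C) {N : ℕ}
    (ha : ∀ n ≥ N, ∀ i < n, 0 ≤ a n i ∧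
      a n i ≤ C * (((n - i : ℕ) : ℝ) ^ β * (n : ℝ) ^ (-(p + β))))
    {γ K : ℝ} (hγ : 0 < γ)
    (hw : ∀ n : ℕ, 1 ≤ n → ∑ k ∈ Ico 1 n, ((k : ℝ) ^ β * (n : ℝ) ^ (-(p + β))) ^ (min 2 (r / p))
      ≤ K * (n : ℝ) ^ (-γ))
    {ε d : ℝ} (hε : 0 < ε) (hd : 0 < d) (hdγ : 4 * r * d ≤ γ * ε) :
    ∃ K' : ℝ, 0 ≤ K' ∧ ∃ N' : ℕ, ∀ n ≥ N',
      S.capacity {ω | ∃ j ≤ n - 1, ε < ∑ i ∈ Icc 1 j,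
        clip d ((if i < n then a n i else 0) * (τ * Xs i ω))} ≤
      ENNReal.ofReal (K' * (n : ℝ) ^ (-r)) := by
  have hp0 : 0 < p := by linarith
  have hq : 0 < r / p := div_pos (by linarith) hp0
  have hτX : (fun ω => τ * X ω) ∈ S.H := S.const_mul_mem τ hX
  have hfin' : ∫⁻ y in Set.Ioi (0 : ℝ), S.capacity {ω | y < momentFun r p β |τ * X ω|} < ⊤ := by
    simpa only [abs_mul, hτ, one_mul] using hfin
  set s₁ : ℝ := if p ≤ 1 then r / p else min 1 (r / p) with hs₁
  have hs₁0 : 0 < s₁ := by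
    rw [hs₁]; split_ifs
    · exact hq
    · exact lt_min one_pos hq
  have hps₁ : 1 < p * s₁ := by
    rw [hs₁]; split_ifs with h
    · rw [mul_div_cancel₀ _ hp0.ne']; exact hr
    · rw [mul_min_of_nonneg _ _ hp0.le, mul_one, mul_div_cancel₀ _ hp0.ne']
      exact lt_min (not_le.1 h) hr
  set s₂ : ℝ := min 2 (r / p) with hs₂
  have hs₂0 : 0 < s₂ := lt_min two_pos hq
  obtain ⟨M₁, hM₁, hev₁⟩ := hS.exists_ev_clip_le hτX hr hp0 hα hfin' hmean hd
  rw [← hs₁] at hev₁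
  obtain ⟨M₂, hM₂, hev₂⟩ := hS.exists_ev_clip_sq_le hτX hr hp0 hα hfin' hs₂0 (min_le_right _ _)
    (min_le_left _ _) hd
  obtain ⟨K₁, γ₁, hK₁, hγ₁, hw₁⟩ := exists_sum_weight_rpow_le hα hs₁0 hps₁
  have hlim : Filter.Tendsto (fun n : ℕ => M₁ * (C ^ s₁ * (K₁ * (n : ℝ) ^ (-γ₁)))) Filter.atTop
      (nhds 0) := by
    have := (((tendsto_rpow_neg_atTop hγ₁).comp tendsto_natCast_atTop_atTop).const_mul
      K₁).const_mul (C ^ s₁) |>.const_mul M₁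
    simpa using this
  obtain ⟨N₁, hN₁⟩ := Filter.eventually_atTop.1
    (hlim.eventually_le_const (show 0 < ε / 2 by positivity))
  refine ⟨Real.exp ((2 * r / ε) ^ 2 * (4 / γ) ^ 2 * (M₂ * (C ^ s₂ * K))), (Real.exp_pos _).le,
    max N (max N₁ 2), fun n hn => ?_⟩
  have hnN : N ≤ n := (le_max_left _ _).trans hn
  have hnN₁ : N₁ ≤ n := ((le_max_left _ _).trans (le_max_right _ _)).trans hn
  have hn2 : 2 ≤ n := ((le_max_right _ _).trans (le_max_right _ _)).trans hn
  have hn1 : 1 ≤ n := by omega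
  have hn2' : (2 : ℝ) ≤ n := by exact_mod_cast hn2
  -- Setting the weights to 0 for i ≥ n makes them nonnegative for all i; the array is controlled
  -- only for i < n.
  set A : ℕ → ℝ := fun i => if i < n then a n i else 0 with hA
  have hA0 : ∀ i, 0 ≤ A i := fun i => by
    simp only [hA]; split_ifs with h
    · exact (ha n hnN i h).1
    · exact le_rfl
  have hZm : ∀ i, Measurable fun y => clip d (A i * (τ * y)) := fun i =>
    (measurable_clip d).comp (by fun_prop)
  have hZb : ∀ i, 1 ≤ i → S.IsBdd (fun ω => clip d (A i * (τ * Xs i ω))) := fun i hi =>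
    isBdd_clip (S.const_mul_mem τ (hXs i hi)) hd.le (A i)
  have hl : 0 < 2 * r * Real.log n / ε := by
    have : 0 < Real.log n := Real.log_pos (by linarith)
    positivity
  have key := hindep.capacity_exists_sum_le hXs (Z := fun i y => clip d (A i * (τ * y))) hZm
    (fun i y => abs_clip_le hd.le _) (fun i hi => (hZb i hi).1)
    (μ := fun i => M₁ * A i ^ s₁) (σ := fun i => M₂ * A i ^ s₂)
    (fun i hi => ?_) (fun i hi => ?_)
    (fun i => mul_nonneg hM₁ (Real.rpow_nonneg (hA0 i) _))
    (fun i => mul_nonneg hM₂ (Real.rpow_nonneg (hA0 i) _)) hl ε (n - 1)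
  · refine key.trans (ENNReal.ofReal_le_ofReal ?_)
    refine exp_bound_le (by linarith) hε hγ hdγ (by linarith) ?_ ?_ ?_
    · rw [← mul_sum]
      refine le_trans ?_ (hN₁ n hnN₁)
      refine mul_le_mul_of_nonneg_left ?_ hM₁
      refine (sum_array_rpow_le hC hs₁0 (ha n hnN)).trans ?_
      exact mul_le_mul_of_nonneg_left (hw₁ n hn1) (by positivity)
    · exact sum_nonneg fun i _ => mul_nonneg hM₂ (Real.rpow_nonneg (hA0 i) _)
    · rw [← mul_sum, mul_assoc, mul_assoc]
      refine mul_le_mul_of_nonneg_left ?_ hM₂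
      refine (sum_array_rpow_le hC hs₂0 (ha n hnN)).trans ?_
      exact mul_le_mul_of_nonneg_left (hw n hn1) (by positivity)
  · refine ((hident i hi).ev_eq (f := fun y => clip d (A i * (τ * y))) (hZm i) (hZb i hi)
      (isBdd_clip hτX hd.le (A i))).le.trans (hev₁ _ (hA0 i))
  · have h1 : S.IsBdd (fun ω => clip d (A i * (τ * Xs i ω)) ^ 2) := by
      simpa [sq] using (hZb i hi).mul (hZb i hi)
    have h2 : S.IsBdd (fun ω => clip d (A i * (τ * X ω)) ^ 2) := by
      simpa [sq] using (isBdd_clip hτX hd.le (A i)).mul (isBdd_clip hτX hd.le (A i))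
    exact ((hident i hi).ev_eq (f := fun y => clip d (A i * (τ * y)) ^ 2) ((hZm i).pow_const 2)
      h1 h2).le.trans (hev₂ _ (hA0 i))

/-- The bounds on the pair count supply the counting hypothesis of `tsum_capacity_le_lintegral`. -/
theorem tsum_threshold_lt_top {X : Ω → ℝ} {r p β : ℝ} (hr : 1 < r) (hp : 0 < p) (hα : 0 < p + β)
    (hfin : ∫⁻ y in Set.Ioi (0 : ℝ), S.capacity {ω | y < momentFun r p β |X ω|} < ⊤)
    {δ : ℝ} (hδ : 0 < δ) :
    ∑' z, pairWeight r z * S.capacity {ω | threshold (p + β) β δ z < |X ω|} < ⊤ := by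
  obtain ⟨C₁, hC₁, h₁⟩ := exists_thresholdCount_le hr hp hα
  obtain ⟨C₂, C₃, hC₂, hC₃, h₂⟩ := exists_countBound_le_momentFun hr hp hα hδ
  refine (tsum_capacity_le_lintegral (h := momentFun r p β) (C := ENNReal.ofReal (C₁ * C₂))
    (C' := ENNReal.ofReal (C₁ * C₃)) (fun z => ?_) (momentFun_monotoneOn hr hp hα)
    ENNReal.ofReal_ne_top (fun T hT => ?_) fun ω => |X ω|).trans_lt ?_
  · unfold threshold; positivity
  · refine (h₁ δ T hδ hT).trans ?_
    rw [← ENNReal.ofReal_mul (by positivity), ← ENNReal.ofReal_add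
      (mul_nonneg (by positivity) (momentFun_nonneg hT)) (by positivity)]
    refine ENNReal.ofReal_le_ofReal ?_
    have := mul_le_mul_of_nonneg_left (h₂ T hT) hC₁.le
    linarith
  · exact ENNReal.add_lt_top.2 ⟨ENNReal.mul_lt_top ENNReal.ofReal_lt_top hfin,
      ENNReal.ofReal_lt_top⟩

theorem lintegral_momentFun_lt_top {X : Ω → ℝ} {r p β : ℝ} (hr : 1 < r) (hp : 0 < p)
    (hα : 0 < p + β)
    (hfin : ∑' z, pairWeight r z * S.capacity {ω | threshold (p + β) β 1 z < |X ω|} < ⊤) :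
    ∫⁻ y in Set.Ioi (0 : ℝ), S.capacity {ω | y < momentFun r p β |X ω|} < ⊤ := by
  obtain ⟨c₁, hc₁, h₁⟩ := exists_le_thresholdCount (r := r) hp hα
  obtain ⟨C₂, C₃, hC₂, hC₃, h₂⟩ := exists_momentFun_le_countBound hr hp hα
  refine (lintegral_le_tsum_capacity (h := momentFun r p β) (C := ENNReal.ofReal (C₂ / c₁))
    (C' := ENNReal.ofReal C₃) (momentFun_monotoneOn hr hp hα) (momentFun_continuousOn hr hp hα)
    (momentFun_zero hr hp hα) (momentFun_tendsto hr hp hα)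
    ENNReal.ofReal_ne_top (fun T hT => ?_) (Y := fun ω => |X ω|) fun ω => abs_nonneg _).trans_lt
      (ENNReal.add_lt_top.2 ⟨ENNReal.mul_lt_top ENNReal.ofReal_lt_top hfin,
      ENNReal.ofReal_lt_top⟩)
  refine le_trans ?_ (add_le_add_left (mul_le_mul_right (h₁ T hT) _) _)
  rw [← ENNReal.ofReal_mul (by positivity), ← ENNReal.ofReal_add (by positivity) hC₃]
  refine ENNReal.ofReal_le_ofReal ((h₂ T hT).trans (le_of_eq ?_))
  field_simp

theorem lt_maxAbsWeightedSum_iff {Ω : Type*} {a : ℕ → ℕ → ℝ} {X : ℕ → Ω → ℝ} {n : ℕ+} {ω : Ω} {ε : ℝ} :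
    ε < maxAbsWeightedSum a X n ω ↔
      ∃ j < (n : ℕ), ε < |∑ i ∈ Icc 1 j, a n i * X i ω| := by
  rw [maxAbsWeightedSum, Finset.lt_sup'_iff]
  simp

theorem capacity_threshold_eq {X : Ω → ℝ} {Xs : ℕ → Ω → ℝ} (hX : X ∈ S.H)
    (hXs : ∀ n, 1 ≤ n → Xs n ∈ S.H) (hident : ∀ n, 1 ≤ n → S.IdentDistrib (Xs n) X)
    {i : ℕ} (hi : 1 ≤ i) (t : ℝ) : S.capacity {ω | t < |Xs i ω|} = S.capacity {ω | t < |X ω|} :=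
  (hident i hi).capacity_preimage_eq (S.measurable_of_mem _ (hXs i hi)) (S.measurable_of_mem _ hX)
    (B := {y | t < |y|}) (measurableSet_lt measurable_const (by fun_prop))

/-- The moment condition implies complete convergence. -/
theorem tsum_capacity_maxAbsWeightedSum_lt_top (hS : S.CountablySubadditive)
    {X : Ω → ℝ} {Xs : ℕ → Ω → ℝ} (hX : X ∈ S.H) (hXs : ∀ n, 1 ≤ n → Xs n ∈ S.H)
    (hindep : S.IndepSeq Xs) (hident : ∀ n, 1 ≤ n → S.IdentDistrib (Xs n) X)
    {r p β : ℝ} (hr : 1 < r) (hp : 1 / 2 < p) (hα : 0 < p + β)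
    (hfin : ∫⁻ y in Set.Ioi (0 : ℝ), S.capacity {ω | y < momentFun r p β |X ω|} < ⊤)
    (hmean : p ≤ 1 → S.E X = 0 ∧ -S.E (fun ω => -X ω) = 0)
    {a : ℕ → ℕ → ℝ} (ha : ArrayApprox a
      (fun n i => (((n : ℝ) - (i : ℝ)) / (n : ℝ)) ^ β * (1 / (n : ℝ)) ^ p))
    {ε : ℝ} (hε : 0 < ε) :
    ∑' n : ℕ+, ENNReal.ofReal (((n : ℕ) : ℝ) ^ (r - 2)) *
        S.capacity {ω | ε < maxAbsWeightedSum a Xs n ω} < ⊤ := by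
  have hp0 : 0 < p := by linarith
  have hq : 0 < r / p := div_pos (by linarith) hp0
  obtain ⟨c, C, hc, hC, N, hab⟩ := ha.exists_bounds
  have ha' : ∀ n ≥ N, ∀ i < n, 0 ≤ a n i ∧
      a n i ≤ C * (((n - i : ℕ) : ℝ) ^ β * (n : ℝ) ^ (-(p + β))) := fun n hn i hi =>
    ⟨le_trans (by positivity) (hab n hn i hi).1, (hab n hn i hi).2⟩
  have hs₂0 : 0 < min 2 (r / p) := lt_min two_pos hq
  -- The product is min(2p, r); p > 1/2 makes the variance sums decay.
  have hps₂ : 1 < p * min 2 (r / p) := by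
    rw [mul_min_of_nonneg _ _ hp0.le, mul_div_cancel₀ _ hp0.ne']
    exact lt_min (by linarith) hr
  obtain ⟨K, γ, hK, hγ, hw⟩ := exists_sum_weight_rpow_le hα hs₂0 hps₂
  set d := γ * ε / (4 * r) with hd
  have hd0 : 0 < d := by positivity
  have hdγ : 4 * r * d ≤ γ * ε := by rw [hd, mul_div_cancel₀ _ (by positivity)]
  obtain ⟨K₁, hK₁, N₁, h₁⟩ := exists_capacity_clip_sum_le hS hX hXs hindep hident hr hp hα hfin
    (τ := 1) (by simp) (fun h => by simpa using (hmean h).1) hC ha' hγ hw hε hd0 hdγ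
  obtain ⟨K₂, hK₂, N₂, h₂⟩ := exists_capacity_clip_sum_le hS hX hXs hindep hident hr hp hα hfin
    (τ := -1) (by simp) (fun h => by simpa using (hmean h).2) hC ha' hγ hw hε hd0 hdγ
  set M := max N (max N₁ N₂) with hM
  -- Three contributions: finitely many n, where the capacity is at most 1; one large term; and the
  -- truncated sums, with n^{r-2} n^{-r} = n^{-2}.
  set f : ℕ → ℝ≥0∞ := fun n => (if n < M then ENNReal.ofReal ((n : ℝ) ^ (r - 2)) else 0) +
    (ENNReal.ofReal ((n : ℝ) ^ (r - 2)) * ∑ k ∈ Ico 1 n,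
      S.capacity {ω | threshold (p + β) β (d / C) (k, n) < |X ω|} +
      ENNReal.ofReal ((K₁ + K₂) * (n : ℝ) ^ (-2 : ℝ))) with hf
  have hle : ∀ n : ℕ+, ENNReal.ofReal (((n : ℕ) : ℝ) ^ (r - 2)) *
        S.capacity {ω | ε < maxAbsWeightedSum a Xs n ω} ≤ f n := by
    intro n
    obtain ⟨m, hm⟩ := n
    simp only [PNat.mk_coe]
    rcases lt_or_ge m M with hmM | hmM
    · simp only [hf, if_pos hmM]
      exact le_add_right (mul_le_of_le_one_right' (S.capacity_le_one _))
    have hN : N ≤ m := (le_max_left _ _).trans hmM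
    have hN₁ : N₁ ≤ m := ((le_max_left _ _).trans (le_max_right _ _)).trans hmM
    have hN₂ : N₂ ≤ m := ((le_max_right _ _).trans (le_max_right _ _)).trans hmM
    have hm0 : (0 : ℝ) < m := by exact_mod_cast hm
    simp only [hf, if_neg (not_lt.2 hmM), zero_add]
    set B : ℕ → Set Ω := fun i => {ω | threshold (p + β) β (d / C) (m - i, m) < |Xs i ω|} with hB
    set E : ℝ → Set Ω := fun τ => {ω | ∃ j ≤ m - 1, ε < ∑ i ∈ Icc 1 j,
        clip d ((if i < m then a m i else 0) * (τ * Xs i ω))} with hE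
    -- Off the events `B i` truncation is inactive: the upper bound C k^β m^{-α} times the threshold
    -- with δ = d/C is exactly d.
    have hsub : {ω | ε < maxAbsWeightedSum a Xs ⟨m, hm⟩ ω} ⊆
        (⋃ i ∈ Icc 1 (m - 1), B i) ∪ (E 1 ∪ E (-1)) := by
      intro ω hω
      obtain ⟨j, hj, hω'⟩ := lt_maxAbsWeightedSum_iff.1 hω
      simp only [PNat.mk_coe] at hj hω'
      by_cases hBω : ω ∈ ⋃ i ∈ Icc 1 (m - 1), B i
      · exact Or.inl hBω
      right
      simp only [Set.mem_iUnion, not_exists] at hBω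
      have hclip : ∀ τ : ℝ, |τ| = 1 → ∀ i ∈ Icc 1 j,
          clip d ((if i < m then a m i else 0) * (τ * Xs i ω)) = τ * (a m i * Xs i ω) := by
        intro τ hτ i hi
        obtain ⟨hi1, hi2⟩ := mem_Icc.1 hi
        have him : i < m := by omega
        have h3 : |Xs i ω| ≤ threshold (p + β) β (d / C) (m - i, m) :=
          not_lt.1 (hBω i (mem_Icc.2 ⟨hi1, by omega⟩))
        have hk0 : (0 : ℝ) < ((m - i : ℕ) : ℝ) := by
          have : 0 < m - i := by omega
          exact_mod_cast this
        rw [if_pos him, clip_eq_self]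
        · ring
        · obtain ⟨h4, h5⟩ := ha' m hN i him
          rw [abs_mul, abs_mul, hτ, one_mul, abs_of_nonneg h4]
          calc a m i * |Xs i ω| ≤ (C * (((m - i : ℕ) : ℝ) ^ β * (m : ℝ) ^ (-(p + β)))) *
                threshold (p + β) β (d / C) (m - i, m) :=
                mul_le_mul h5 h3 (abs_nonneg _) (by positivity)
            _ = d := by
                simp only [threshold]
                rw [Real.rpow_neg hm0.le, Real.rpow_neg hk0.le]
                have h6 : (0 : ℝ) < (m : ℝ) ^ (p + β) := by positivity
                have h7 : (0 : ℝ) < ((m - i : ℕ) : ℝ) ^ β := by positivity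
                field_simp
            _ ≤ d := le_rfl
      rcases lt_abs.1 hω' with h | h
      · left
        refine ⟨j, by omega, ?_⟩
        rw [sum_congr rfl (hclip 1 (by simp)), ← mul_sum, one_mul]
        exact h
      · right
        refine ⟨j, by omega, ?_⟩
        rw [sum_congr rfl (hclip (-1) (by simp)), ← mul_sum, neg_one_mul]
        exact h
    have hBm : ∀ i ∈ Icc 1 (m - 1), MeasurableSet (B i) := fun i hi =>
      measurableSet_lt measurable_const
        (S.measurable_of_mem _ (abs_mem (hXs i (mem_Icc.1 hi).1)))
    have hEm : ∀ τ, MeasurableSet (E τ) := fun τ => by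
      refine measurableSet_exists_le_lt (fun j => ?_) _ _
      refine Finset.measurable_sum _ fun i hi => (measurable_clip d).comp ?_
      have := S.measurable_of_mem _ (hXs i (mem_Icc.1 hi).1)
      fun_prop
    have hcap : S.capacity {ω | ε < maxAbsWeightedSum a Xs ⟨m, hm⟩ ω} ≤
        ∑ k ∈ Ico 1 m, S.capacity {ω | threshold (p + β) β (d / C) (k, m) < |X ω|} +
        ENNReal.ofReal ((K₁ + K₂) * (m : ℝ) ^ (-r)) := by
      refine (capacity_mono hsub).trans ((capacity_union_le (Finset.measurableSet_biUnion _ hBm)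
        ((hEm _).union (hEm _))).trans (add_le_add ?_ ?_))
      · refine (capacity_biUnion_le _ hBm).trans (le_of_eq ?_)
        rw [← sum_Icc_comp_sub m
          (fun k => S.capacity {ω | threshold (p + β) β (d / C) (k, m) < |X ω|})]
        exact sum_congr rfl fun i hi =>
          capacity_threshold_eq hX hXs hident (mem_Icc.1 hi).1 _
      · refine (capacity_union_le (hEm _) (hEm _)).trans ?_
        rw [add_mul, ENNReal.ofReal_add (by positivity) (by positivity)]
        exact add_le_add (h₁ m hN₁) (h₂ m hN₂)
    refine (mul_le_mul_right hcap _).trans (le_of_eq ?_)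
    rw [mul_add, ← ENNReal.ofReal_mul (by positivity)]
    congr 2
    rw [mul_left_comm, ← Real.rpow_add hm0]
    ring_nf
  refine lt_of_le_of_lt (ENNReal.tsum_le_tsum hle)
    (lt_of_le_of_lt (ENNReal.tsum_comp_le_tsum_of_injective PNat.coe_injective f) ?_)
  rw [hf, ENNReal.tsum_add, ENNReal.tsum_add]
  refine ENNReal.add_lt_top.2 ⟨?_, ENNReal.add_lt_top.2 ⟨?_, ?_⟩⟩
  · rw [tsum_eq_sum (s := range M) fun n hn => if_neg (by simpa using hn)]
    exact ENNReal.sum_lt_top.2 fun n _ => by split_ifs <;> simp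
  · have := tsum_threshold_lt_top hr hp0 hα hfin (δ := d / C) (by positivity)
    rwa [tsum_pairWeight_mul r
      (fun z => S.capacity {ω | threshold (p + β) β (d / C) z < |X ω|})] at this
  · have : Summable fun n : ℕ => (K₁ + K₂) * (n : ℝ) ^ (-2 : ℝ) :=
      (Real.summable_nat_rpow.2 (by norm_num)).mul_left _
    rw [← ENNReal.ofReal_tsum_of_nonneg (fun n => by positivity) this]
    exact ENNReal.ofReal_lt_top

end SublinearExpectation
end

/-! ### Complete convergence implies the moment condition. -/

noncomputable section

open Finset

namespace SublinearExpectation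

variable {Ω : Type*} [MeasurableSpace Ω] {S : SublinearExpectation Ω}

/-- The sum over `1 ≤ k < n` of the capacities of `{|X| > δ n^α k^{-β}}`. -/
def tailSum (S : SublinearExpectation Ω) (X : Ω → ℝ) (α β δ : ℝ) (n : ℕ) : ℝ :=
  ∑ k ∈ Ico 1 n, (S.capacity {ω | threshold α β δ (k, n) < |X ω|}).toReal

theorem tailSum_nonneg (X : Ω → ℝ) (α β δ : ℝ) (n : ℕ) : 0 ≤ S.tailSum X α β δ n :=
  sum_nonneg fun _ _ => ENNReal.toReal_nonneg

theorem ofReal_tailSum (X : Ω → ℝ) (α β δ : ℝ) (n : ℕ) :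
    ENNReal.ofReal (S.tailSum X α β δ n) =
      ∑ k ∈ Ico 1 n, S.capacity {ω | threshold α β δ (k, n) < |X ω|} := by
  rw [tailSum, ENNReal.ofReal_sum_of_nonneg fun _ _ => ENNReal.toReal_nonneg]
  exact sum_congr rfl fun k _ => ENNReal.ofReal_toReal (capacity_ne_top _)

/-- For m ≤ 2n the thresholds grow by at most 2^α from n to m, which the factor 2^α in δ absorbs,
and m allows more values of k. One large value at n thus forces large values on all of [n, 2n]. -/
theorem tailSum_le_tailSum (X : Ω → ℝ) {α β δ : ℝ} (hα : 0 < α) (hδ : 0 < δ) {n m : ℕ}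
    (hnm : n ≤ m) (hm : m ≤ 2 * n) :
    S.tailSum X α β (δ * 2 ^ α) n ≤ S.tailSum X α β δ m := by
  refine (sum_le_sum fun k hk => ?_).trans (sum_le_sum_of_subset_of_nonneg
    (Ico_subset_Ico_right hnm) fun _ _ _ => ENNReal.toReal_nonneg)
  refine ENNReal.toReal_mono (capacity_ne_top _) (capacity_mono fun ω hω => ?_)
  refine lt_of_le_of_lt ?_ (show threshold α β (δ * 2 ^ α) (k, n) < |X ω| from hω)
  have hm' : (m : ℝ) ≤ 2 * n := by exact_mod_cast hm
  have h := Real.rpow_le_rpow (Nat.cast_nonneg m) hm' hα.le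
  rw [Real.mul_rpow two_pos.le (Nat.cast_nonneg n)] at h
  simp only [threshold]
  calc δ * ((m : ℝ) ^ α * (k : ℝ) ^ (-β)) ≤ δ * ((2 ^ α * (n : ℝ) ^ α) * (k : ℝ) ^ (-β)) := by
        gcongr
    _ = _ := by ring

/-- If |X_i| exceeds its threshold then |a_{ni} X_i| > cδ, a jump that some partial sum of modulus
above cδ/2 must witness; independence bounds the capacity of the union of these events from below.
-/
theorem one_sub_exp_tailSum_le {X : Ω → ℝ} {Xs : ℕ → Ω → ℝ} (hX : X ∈ S.H)
    (hXs : ∀ n, 1 ≤ n → Xs n ∈ S.H)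
    (hindep : S.IndepSeq Xs) (hident : ∀ n, 1 ≤ n → S.IdentDistrib (Xs n) X)
    {α β c δ : ℝ} (hc : 0 < c) (hδ : 0 < δ) {a : ℕ → ℕ → ℝ} (n : ℕ+)
    (ha : ∀ i < (n : ℕ), c * ((((n : ℕ) - i : ℕ) : ℝ) ^ β * ((n : ℕ) : ℝ) ^ (-α)) ≤ a n i) :
    ENNReal.ofReal (1 - Real.exp (-S.tailSum X α β δ n)) ≤
      S.capacity {ω | c * δ / 2 < maxAbsWeightedSum a Xs n ω} := by
  set B : ℕ → Set ℝ := fun i => {y | threshold α β δ ((n : ℕ) - i, (n : ℕ)) < |y|} with hB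
  have hBm : ∀ i, MeasurableSet (B i) := fun i => measurableSet_lt measurable_const (by fun_prop)
  have key := hindep.one_sub_exp_le_capacity_iUnion hXs hBm ((n : ℕ) - 1)
  have hsum : ∑ i ∈ Icc 1 ((n : ℕ) - 1), (S.capacity (Xs i ⁻¹' B i)).toReal =
      S.tailSum X α β δ n := by
    rw [tailSum, ← sum_Icc_comp_sub (n : ℕ)
      (fun k => (S.capacity {ω | threshold α β δ (k, (n : ℕ)) < |X ω|}).toReal)]
    refine sum_congr rfl fun i hi => ?_
    exact congrArg _ (capacity_threshold_eq hX hXs hident (mem_Icc.1 hi).1 _)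
  rw [hsum] at key
  refine key.trans (capacity_mono fun ω hω => ?_)
  simp only [Set.mem_iUnion, Set.mem_preimage] at hω
  obtain ⟨i, hi, hω⟩ := hω
  obtain ⟨hi1, hi2⟩ := mem_Icc.1 hi
  have hn : 0 < (n : ℕ) := n.pos
  have hin : i < (n : ℕ) := by omega
  have hn0 : (0 : ℝ) < ((n : ℕ) : ℝ) := by exact_mod_cast hn
  have hk0 : (0 : ℝ) < (((n : ℕ) - i : ℕ) : ℝ) := by
    have : 0 < (n : ℕ) - i := by omega
    exact_mod_cast this
  have hbig : c * δ < |a n i * Xs i ω| := by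
    have h1 : threshold α β δ ((n : ℕ) - i, (n : ℕ)) < |Xs i ω| := hω
    have h2 := ha i hin
    have h3 : 0 < c * ((((n : ℕ) - i : ℕ) : ℝ) ^ β * ((n : ℕ) : ℝ) ^ (-α)) := by positivity
    rw [abs_mul, abs_of_pos (h3.trans_le h2)]
    calc c * δ = c * ((((n : ℕ) - i : ℕ) : ℝ) ^ β * ((n : ℕ) : ℝ) ^ (-α)) *
          threshold α β δ ((n : ℕ) - i, (n : ℕ)) := by
          simp only [threshold]
          rw [Real.rpow_neg hn0.le, Real.rpow_neg hk0.le]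
          have h6 : (0 : ℝ) < ((n : ℕ) : ℝ) ^ α := by positivity
          have h7 : (0 : ℝ) < (((n : ℕ) - i : ℕ) : ℝ) ^ β := by positivity
          field_simp
      _ < c * ((((n : ℕ) - i : ℕ) : ℝ) ^ β * ((n : ℕ) : ℝ) ^ (-α)) * |Xs i ω| :=
          mul_lt_mul_of_pos_left h1 h3
      _ ≤ _ := by gcongr
  change c * δ / 2 < maxAbsWeightedSum a Xs n ω
  rw [lt_maxAbsWeightedSum_iff]
  -- The partial sums up to i and i - 1 would both be at most cδ/2 in modulus, contradicting their
  -- difference a_{ni} X_i.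
  by_contra hcon
  push Not at hcon
  have h1 := hcon i hin
  have h2 := hcon (i - 1) (by omega)
  obtain ⟨j, rfl⟩ : ∃ j, i = j + 1 := ⟨i - 1, by omega⟩
  rw [sum_Icc_succ_top (by omega)] at h1
  rw [Nat.add_sub_cancel] at h2
  rw [abs_le] at h1 h2
  rcases lt_abs.1 hbig with h | h <;> linarith

theorem tsum_one_sub_exp_tailSum_lt_top {X : Ω → ℝ} {Xs : ℕ → Ω → ℝ} (hX : X ∈ S.H)
    (hXs : ∀ n, 1 ≤ n → Xs n ∈ S.H)
    (hindep : S.IndepSeq Xs) (hident : ∀ n, 1 ≤ n → S.IdentDistrib (Xs n) X)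
    {r p β : ℝ} {a : ℕ → ℕ → ℝ} (ha : ArrayApprox a
      (fun n i => (((n : ℝ) - (i : ℝ)) / (n : ℝ)) ^ β * (1 / (n : ℝ)) ^ p))
    (hconv : ∀ ε : ℝ, 0 < ε → ∑' n : ℕ+, ENNReal.ofReal (((n : ℕ) : ℝ) ^ (r - 2)) *
        S.capacity {ω | ε < maxAbsWeightedSum a Xs n ω} < ⊤) {δ : ℝ} (hδ : 0 < δ) :
    ∑' n : ℕ, ENNReal.ofReal ((n : ℝ) ^ (r - 2)) *
      ENNReal.ofReal (1 - Real.exp (-S.tailSum X (p + β) β δ n)) < ⊤ := by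
  obtain ⟨c, C, hc, hC, N, hab⟩ := ha.exists_bounds
  -- The n = 0 term vanishes (empty tail sum), so the series can be shifted to match the sum over
  -- `ℕ+`.
  have h0 : ENNReal.ofReal (1 - Real.exp (-S.tailSum X (p + β) β δ 0)) = 0 := by
    simp [tailSum]
  rw [tsum_eq_zero_add' ENNReal.summable, h0, mul_zero, zero_add]
  have hfin := hconv (c * δ / 2) (by positivity)
  rw [← Equiv.pnatEquivNat.symm.tsum_eq] at hfin
  refine lt_of_le_of_lt (ENNReal.tsum_le_tsum (g := fun n : ℕ =>
    (if n < N then ENNReal.ofReal (((n + 1 : ℕ) : ℝ) ^ (r - 2)) else 0) +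
      ENNReal.ofReal (((n.succPNat : ℕ) : ℝ) ^ (r - 2)) *
        S.capacity {ω | c * δ / 2 < maxAbsWeightedSum a Xs n.succPNat ω}) fun n => ?_) ?_
  · by_cases hn : n < N
    · rw [if_pos hn]
      refine le_add_right (mul_le_of_le_one_right' ?_)
      rw [ENNReal.ofReal_le_one]
      linarith [Real.exp_pos (-S.tailSum X (p + β) β δ (n + 1))]
    · rw [if_neg hn, zero_add]
      have := one_sub_exp_tailSum_le (β := β) (α := p + β) hX hXs hindep hident hc hδ
        (a := a) n.succPNat
        (fun i hi => (hab _ (by rw [Nat.succPNat_coe]; omega) i hi).1)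
      exact mul_le_mul_right this _
  · rw [ENNReal.tsum_add]
    refine ENNReal.add_lt_top.2 ⟨?_, hfin⟩
    rw [tsum_eq_sum (s := range N) fun n hn => if_neg (by simpa using hn)]
    exact ENNReal.sum_lt_top.2 fun n _ => by split_ifs <;> simp

/-- The weights m^{r-2} over (n, 2n] sum to order n^{r-1}, which diverges as r > 1, while their
product with the common lower bound 1 - e^{-u_n} stays below the sum of the series. -/
theorem eventually_tailSum_le {X : Ω → ℝ} {r α β δ : ℝ} (hr : 1 < r) (hα : 0 < α) (hδ : 0 < δ)
    (hfin : ∑' n : ℕ, ENNReal.ofReal ((n : ℝ) ^ (r - 2)) *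
      ENNReal.ofReal (1 - Real.exp (-S.tailSum X α β δ n)) < ⊤) :
    ∀ᶠ n in Filter.atTop, S.tailSum X α β (δ * 2 ^ α) n ≤ 1 / 2 := by
  set I := ∑' n : ℕ, ENNReal.ofReal ((n : ℝ) ^ (r - 2)) *
      ENNReal.ofReal (1 - Real.exp (-S.tailSum X α β δ n)) with hI
  obtain ⟨c, hc, hsum⟩ := exists_le_sum_Ioc_rpow (r - 2)
  have hlim : Filter.Tendsto (fun n : ℕ => c * (2 * (n : ℝ)) ^ (r - 2 + 1)) Filter.atTop
      Filter.atTop :=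
    ((tendsto_rpow_atTop (by linarith)).comp
      (tendsto_natCast_atTop_atTop.const_mul_atTop two_pos)).const_mul_atTop hc
  -- Weight at least 3I + 1 forces 1 - e^{-u} ≤ 1/3; then e^{-u}(1 + u) ≤ 1 gives u ≤ 1/2.
  filter_upwards [hlim.eventually_ge_atTop (3 * I.toReal + 1), Filter.eventually_ge_atTop 2]
    with n hn hn2
  set u := S.tailSum X α β (δ * 2 ^ α) n with hu
  have hu0 : 0 ≤ u := tailSum_nonneg _ _ _ _ _
  have he : 0 ≤ 1 - Real.exp (-u) := by
    rw [sub_nonneg]; exact Real.exp_le_one_iff.2 (by linarith)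
  have hn2' : (2 : ℝ) ≤ n := by exact_mod_cast hn2
  have h1 := hsum (2 * (n : ℝ)) (by linarith)
  have e1 : ⌊2 * (n : ℝ) / 2⌋₊ = n := by
    rw [mul_div_cancel_left₀ _ (two_ne_zero)]; exact Nat.floor_natCast n
  have e2 : ⌊2 * (n : ℝ)⌋₊ = 2 * n := by
    rw [show 2 * (n : ℝ) = ((2 * n : ℕ) : ℝ) by push_cast; ring]; exact Nat.floor_natCast _
  rw [e1, e2] at h1
  have h2 : (∑ m ∈ Ioc n (2 * n), (m : ℝ) ^ (r - 2)) * (1 - Real.exp (-u)) ≤ I.toReal := by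
    rw [← ENNReal.ofReal_le_iff_le_toReal hfin.ne, sum_mul,
      ENNReal.ofReal_sum_of_nonneg fun m _ => mul_nonneg (by positivity) he]
    refine (sum_le_sum fun m hm => ?_).trans (ENNReal.sum_le_tsum (Ioc n (2 * n)))
    obtain ⟨hm1, hm2⟩ := mem_Ioc.1 hm
    rw [ENNReal.ofReal_mul (by positivity)]
    gcongr
    exact tailSum_le_tailSum X hα hδ hm1.le hm2
  have h3 : 1 - Real.exp (-u) ≤ 1 / 3 := by
    have hI0 : 0 ≤ I.toReal := ENNReal.toReal_nonneg
    have h4 := mul_le_mul_of_nonneg_right (hn.trans h1) he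
    have h5 : (3 * I.toReal + 1) * (1 - Real.exp (-u)) ≤ I.toReal := h4.trans h2
    by_contra hcon
    push Not at hcon
    nlinarith
  have h6 : Real.exp (-u) * (u + 1) ≤ 1 := by
    calc _ ≤ Real.exp (-u) * Real.exp u := by
          gcongr; exact Real.add_one_le_exp u
      _ = 1 := by rw [← Real.exp_add]; simp
  nlinarith

/-- Complete convergence implies the moment condition. -/
theorem lintegral_momentFun_lt_top_of_convergence {X : Ω → ℝ} {Xs : ℕ → Ω → ℝ} (hX : X ∈ S.H)
    (hXs : ∀ n, 1 ≤ n → Xs n ∈ S.H)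
    (hindep : S.IndepSeq Xs) (hident : ∀ n, 1 ≤ n → S.IdentDistrib (Xs n) X)
    {r p β : ℝ} (hr : 1 < r) (hp : 0 < p) (hα : 0 < p + β)
    {a : ℕ → ℕ → ℝ} (ha : ArrayApprox a
      (fun n i => (((n : ℝ) - (i : ℝ)) / (n : ℝ)) ^ β * (1 / (n : ℝ)) ^ p))
    (hconv : ∀ ε : ℝ, 0 < ε → ∑' n : ℕ+, ENNReal.ofReal (((n : ℕ) : ℝ) ^ (r - 2)) *
        S.capacity {ω | ε < maxAbsWeightedSum a Xs n ω} < ⊤) :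
    ∫⁻ y in Set.Ioi (0 : ℝ), S.capacity {ω | y < momentFun r p β |X ω|} < ⊤ := by
  have hs : ∀ δ : ℝ, 0 < δ → ∑' n : ℕ, ENNReal.ofReal ((n : ℝ) ^ (r - 2)) *
      ENNReal.ofReal (1 - Real.exp (-S.tailSum X (p + β) β δ n)) < ⊤ := fun δ hδ =>
    tsum_one_sub_exp_tailSum_lt_top hX hXs hindep hident ha hconv hδ
  -- This δ is chosen so that the loss 2^α of the doubling step ends at δ = 1.
  have hδ0 : (0 : ℝ) < ((2 : ℝ) ^ (p + β))⁻¹ := by positivity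
  have hev := eventually_tailSum_le hr hα hδ0 (hs _ hδ0)
  rw [inv_mul_cancel₀ (by positivity)] at hev
  obtain ⟨N, hN⟩ := Filter.eventually_atTop.1 hev
  refine lintegral_momentFun_lt_top hr hp hα ?_
  rw [tsum_pairWeight_mul r (fun z => S.capacity {ω | threshold (p + β) β 1 z < |X ω|})]
  simp only [← ofReal_tailSum]
  refine lt_of_le_of_lt (ENNReal.tsum_le_tsum (g := fun n : ℕ =>
    (if n < N then ENNReal.ofReal ((n : ℝ) ^ (r - 2)) *
      ENNReal.ofReal (S.tailSum X (p + β) β 1 n) else 0) +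
      2 * (ENNReal.ofReal ((n : ℝ) ^ (r - 2)) *
      ENNReal.ofReal (1 - Real.exp (-S.tailSum X (p + β) β 1 n)))) fun n => ?_) ?_
  · by_cases hn : n < N
    · rw [if_pos hn]
      exact le_self_add
    · rw [if_neg hn, zero_add, mul_left_comm]
      refine mul_le_mul_right ?_ _
      have hu := hN n (not_lt.1 hn)
      set u := S.tailSum X (p + β) β 1 n with hudef
      have hu0 : 0 ≤ u := tailSum_nonneg _ _ _ _ _
      rw [show (2 : ℝ≥0∞) = ENNReal.ofReal 2 by simp, ← ENNReal.ofReal_mul two_pos.le]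
      refine ENNReal.ofReal_le_ofReal ?_
      -- This yields 1 - e^{-u} ≥ u - u², which is at least u/2 for 0 ≤ u ≤ 1/2.
      have h1 := Real.abs_exp_sub_one_sub_id_le (x := -u)
        (by rw [abs_neg, abs_of_nonneg hu0]; linarith)
      have h2 := (abs_le.1 h1).2
      nlinarith
  · rw [ENNReal.tsum_add, ENNReal.tsum_mul_left]
    refine ENNReal.add_lt_top.2 ⟨?_, ENNReal.mul_lt_top (by simp) (hs 1 one_pos)⟩
    rw [tsum_eq_sum (s := range N) fun n hn => if_neg (by simpa using hn)]
    exact ENNReal.sum_lt_top.2 fun n _ => by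
      split_ifs
      · exact ENNReal.mul_lt_top ENNReal.ofReal_lt_top ENNReal.ofReal_lt_top
      · simp

/-- Exactly one of the three cases is active, and for a nonnegative variable the negative part of
the Choquet expectation vanishes. -/
theorem moment_condition_iff (X : Ω → ℝ) (r p β : ℝ) :
    ((β < -p / r → S.choquet (fun ω => |X ω| ^ ((r - 1) / (p + β))) < ⊤) ∧
      (β = -p / r → S.choquet (fun ω => |X ω| ^ (r / p) * Real.log (1 + |X ω|)) < ⊤) ∧
      (-p / r < β → S.choquet (fun ω => |X ω| ^ (r / p)) < ⊤)) ↔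
    ∫⁻ y in Set.Ioi (0 : ℝ), S.capacity {ω | y < momentFun r p β |X ω|} < ⊤ := by
  rw [← choquet_lt_top_iff fun ω => momentFun_nonneg (abs_nonneg _)]
  rcases lt_trichotomy β (-p / r) with h | h | h
  · simp only [momentFun_of_lt h, h, h.ne, h.not_gt, true_imp_iff, false_imp_iff, and_true]
  · simp only [momentFun_of_eq h, h.not_lt, h.not_gt, false_imp_iff, and_true, true_and]
    exact ⟨fun H => H h, fun H _ => H⟩
  · simp only [momentFun_of_gt h, h, h.ne', h.not_gt, true_imp_iff, false_imp_iff, true_and]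

end SublinearExpectation

end

theorem theorem3p2 {Ω : Type*} [MeasurableSpace Ω] (S : SublinearExpectation Ω)
    (hS : S.CountablySubadditive)
    (X : Ω → ℝ) (Xs : ℕ → Ω → ℝ) (hX : X ∈ S.H) (hXs : ∀ n, 1 ≤ n → Xs n ∈ S.H)
    (hindep : S.IndepSeq Xs) (hident : ∀ n, 1 ≤ n → S.IdentDistrib (Xs n) X)
    (r p β : ℝ) (hr : 1 < r) (hp : 1 / 2 < p) (hβ : 0 < β + p)
    (hmean : p ≤ 1 → S.E X = 0 ∧ -S.E (fun ω => -X ω) = 0)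
    (a : ℕ → ℕ → ℝ)
    (ha : ArrayApprox a
      (fun n i => (((n : ℝ) - (i : ℝ)) / (n : ℝ)) ^ β * (1 / (n : ℝ)) ^ p)) :
    ((β < -p / r → S.choquet (fun ω => |X ω| ^ ((r - 1) / (p + β))) < ⊤) ∧
      (β = -p / r → S.choquet (fun ω => |X ω| ^ (r / p) * Real.log (1 + |X ω|)) < ⊤) ∧
      (-p / r < β → S.choquet (fun ω => |X ω| ^ (r / p)) < ⊤)) ↔
    (∀ ε : ℝ, 0 < ε →
      ∑' n : ℕ+, ENNReal.ofReal (((n : ℕ) : ℝ) ^ (r - 2)) *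
        S.capacity {ω | ε < maxAbsWeightedSum a Xs n ω} < ⊤) := by
  have hα : 0 < p + β := by linarith
  rw [SublinearExpectation.moment_condition_iff]
  exact ⟨fun h ε hε => SublinearExpectation.tsum_capacity_maxAbsWeightedSum_lt_top hS hX hXs hindep
      hident hr hp hα h hmean ha hε,
    fun h => SublinearExpectation.lintegral_momentFun_lt_top_of_convergence hX hXs hindep hident hr
      (by linarith) hα ha h⟩
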